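/- Let $(a_n)_{n\ge 1}$ be a sequence of non-negative real numbers, let $d>0$ be a real number and let $m$ and $l$ be positive integers. Suppose that the Dirichlet series $$L(s)=\sum_{n=1}^{\infty}\frac{a_n}{n^{s}}$$ converges absolutely for $\operatorname{Re}(s)>d$. Suppose also that the function $L^m$ on $\operatorname{Re}(s)>d$ has a meromorphic continuation, again denoted $L(s)^m$, to an open set containing the closed half-plane $\operatorname{Re}(s)\ge d$, that this continuation is holomorphic on that open set except for a pole of order $l$ at $s=d$, and that $$\lim_{s\to d}L(s)^m(s-d)^l=A^m$$ for some real number $A>0$. Then $$\sum_{n\le X}a_n\;\sim\;\frac{A\,X^{d}}{d\,\Gamma(l/m)\,(\log X)^{1-\frac{l}{m}}}\qquad (X\to\infty,\ X\in\mathbb{R}),$$ that is, the quotient of the two sides tends to $1$. -/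

import Mathlib

open Filter Topology

/-!
The statement is a Tauberian theorem of Wiener–Ikehara–Delange type. Put `ρ = l / m` and let `ν` be
the measure with mass `a n * n ^ (-d)` at `log n`, so that `F z = L (d + z)` is the Laplace transform
of `ν` on `0 < re z`, and `X ^ (-d) * ∑ n ≤ X, a n` is the integral of `exp (d (t - x))` against `ν`
over `t ≤ x`, where `x = log X`. It has to be shown that `x ^ (1 - ρ)` times this integral tends to
`A / (Γ(ρ) d)`.

*Analytic input.* Near `0` one has `F z = z ^ (-ρ) g z` with `g` analytic and `g 0 = A`
(`exists_analyticAt_eq_cpow_mul`). Subtracting the finitely many terms `c i * z ^ (i - ρ)` with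
`i < ρ` leaves a remainder `R` (`exists_mild_remainder`). At a zero of the continuation of `L ^ m` on
the line the function `F` need not continue analytically, but `F ^ m` vanishing there to order
`n ≥ 1` forces `F' = O(|z - i y| ^ (1 / m - 1))`, which is integrable along vertical lines
(`mildAt_of_pow_eq`); this weak regularity, called `MildAt`, is all that is needed of `R`, and no
branch of the root has to be continued to the line.

*Smoothed asymptotics.* If the kernel `K` is the Fourier transform of a compactly supported `C¹`
function, pairing `ν` with `K (t - x)` amounts to integrating `F` against a compactly supported
function along a vertical line (`integral_fourier_mul_exp`). The terms `c i * z ^ (i - ρ)` correspond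
to the densities `c i * t ^ (ρ - i - 1) / Γ(ρ - i)`, and one integration by parts shows that `R`
contributes `O(1 / x)` uniformly as the line approaches the boundary (`exists_comparison`). Since
`ρ > 0`, this is smaller than the main term `x ^ (ρ - 1)`.

*Removing the smoothing.* The same applies to all modulations `K u * exp (i ξ u)`, so the
characteristic functions of the rescaled translates of `ν`, weighted by `K`, converge pointwise. By
Lévy's continuity theorem these measures converge weakly. As `K` can be chosen positive with
polynomial decay (`exists_kernel`), it dominates the one-sided exponential, which is then squeezed
between continuous functions (`tendsto_integral_exp_Iic`).
-/

open MeasureTheory FourierTransform Convolution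

/-! ### Test kernels with compactly supported Fourier transform -/

/-- Convolution with the normalised box `1/2 · 1_{[-1,1]}` is a local average. -/
lemma box_convolution_apply (k : ℝ → ℂ) (y : ℝ) :
    ((Set.Icc (-1 : ℝ) 1).indicator (fun _ => (1 / 2 : ℂ)) ⋆[ContinuousLinearMap.mul ℂ ℂ] k) y =
      (1 / 2 : ℂ) * ∫ s in (y - 1)..(y + 1), k s := by
  rw [convolution_def]
  have h : ∀ t : ℝ, (ContinuousLinearMap.mul ℂ ℂ)
      ((Set.Icc (-1 : ℝ) 1).indicator (fun _ => (1 / 2 : ℂ)) t) (k (y - t)) =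
      (Set.Icc (-1 : ℝ) 1).indicator (fun t => (1 / 2 : ℂ) * k (y - t)) t := by
    intro t
    by_cases ht : t ∈ Set.Icc (-1 : ℝ) 1 <;> simp [ht]
  simp_rw [h]
  rw [integral_indicator measurableSet_Icc, integral_Icc_eq_integral_Ioc,
    ← intervalIntegral.integral_of_le (by norm_num), intervalIntegral.integral_const_mul,
    intervalIntegral.integral_comp_sub_left (fun s => k s)]
  simp

lemma fourier_box (w : ℝ) :
    𝓕 ((Set.Icc (-1 : ℝ) 1).indicator (fun _ => (1 / 2 : ℂ))) w =
      (Real.sinc (2 * Real.pi * w) : ℂ) := by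
  rw [Real.fourier_real_eq_integral_exp_smul]
  have h : ∀ v : ℝ, Complex.exp (↑(-2 * Real.pi * v * w) * Complex.I) •
      (Set.Icc (-1 : ℝ) 1).indicator (fun _ => (1 / 2 : ℂ)) v =
      (Set.Icc (-1 : ℝ) 1).indicator (fun v : ℝ => (1 / 2 : ℂ) *
        Complex.exp ((↑(-(2 * Real.pi * w) * v) : ℂ) * Complex.I)) v := by
    intro v
    by_cases hv : v ∈ Set.Icc (-1 : ℝ) 1
    · simp only [hv, Set.indicator_of_mem, smul_eq_mul]
      rw [mul_comm]
      congr 4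
      ring
    · simp [hv]
  simp_rw [h]
  rw [integral_indicator measurableSet_Icc, integral_Icc_eq_integral_Ioc,
    ← intervalIntegral.integral_of_le (by norm_num), intervalIntegral.integral_const_mul]
  by_cases hw : w = 0
  · subst hw
    norm_num
  have hc : -(2 * Real.pi * w) ≠ 0 := by
    simp [Real.pi_ne_zero, hw]
  rw [intervalIntegral.integral_comp_mul_left
    (fun t : ℝ => Complex.exp ((t : ℂ) * Complex.I)) hc]
  have := integral_exp_mul_I_eq_sinc (-(2 * Real.pi * w))
  rw [show -(2 * Real.pi * w) * -1 = -(-(2 * Real.pi * w)) by ring, mul_one, this, Real.sinc_neg]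
  have hc' : ((-(2 * Real.pi * w) : ℝ) : ℂ) ≠ 0 := by exact_mod_cast hc
  rw [Complex.real_smul, Complex.ofReal_inv]
  field_simp

/-- Every power of the `sinc` function from the third on is the Fourier transform of a `C¹`
function with compact support (a B-spline): each convolution with a box gains one degree of
smoothness. -/
lemma exists_fourier_eq_sinc_pow (n : ℕ) :
    ∃ k : ℝ → ℂ, Integrable k ∧ HasCompactSupport k ∧ (1 ≤ n → Continuous k) ∧
      (2 ≤ n → ContDiff ℝ 1 k) ∧
      ∀ w : ℝ, 𝓕 k w = (Real.sinc (2 * Real.pi * w) : ℂ) ^ (n + 1) := by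
  have hbox : Integrable ((Set.Icc (-1 : ℝ) 1).indicator (fun _ => (1 / 2 : ℂ))) :=
    (integrable_indicator_iff measurableSet_Icc).2
      (integrableOn_const (by simp) (by simp))
  have hsupp : HasCompactSupport ((Set.Icc (-1 : ℝ) 1).indicator (fun _ => (1 / 2 : ℂ))) :=
    HasCompactSupport.intro isCompact_Icc fun x hx => Set.indicator_of_notMem hx _
  induction n with
  | zero =>
    exact ⟨_, hbox, hsupp, by simp, by simp, fun w => by rw [fourier_box]; simp⟩
  | succ n ih =>
    obtain ⟨k, hk, hks, hkc, hkd, hkF⟩ := ih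
    have hform := funext (box_convolution_apply k)
    have hprim : ∀ y : ℝ, (1 / 2 : ℂ) * ∫ s in (y - 1)..(y + 1), k s =
        (1 / 2 : ℂ) * ((∫ s in (0 : ℝ)..(y + 1), k s) - ∫ s in (0 : ℝ)..(y - 1), k s) := by
      intro y
      rw [intervalIntegral.integral_interval_sub_left hk.intervalIntegrable
        hk.intervalIntegrable]
    refine ⟨_, hbox.integrable_convolution (ContinuousLinearMap.mul ℂ ℂ) hk,
      hsupp.convolution _ hks, fun _ => ?_,
      fun hn => ?_, fun w => ?_⟩
    · rw [hform]
      simp_rw [hprim]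
      have hc : Continuous fun y : ℝ => ∫ s in (0 : ℝ)..y, k s :=
        intervalIntegral.continuous_primitive (fun a b => hk.intervalIntegrable) 0
      exact continuous_const.mul
        ((hc.comp (continuous_add_const 1)).sub (hc.comp (continuous_sub_right 1)))
    · rw [hform]
      simp_rw [hprim]
      have hkc' : Continuous k := hkc (by omega)
      have hc : ContDiff ℝ 1 fun y : ℝ => ∫ s in (0 : ℝ)..y, k s := by
        rw [contDiff_one_iff_deriv]
        have hd : ∀ y : ℝ, HasDerivAt (fun y : ℝ => ∫ s in (0 : ℝ)..y, k s) (k y) y :=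
          fun y => intervalIntegral.integral_hasDerivAt_right hk.intervalIntegrable
            (hkc'.stronglyMeasurableAtFilter _ _) hkc'.continuousAt
        refine ⟨fun y => (hd y).differentiableAt, ?_⟩
        rw [show deriv (fun y : ℝ => ∫ s in (0 : ℝ)..y, k s) = k from funext fun y => (hd y).deriv]
        exact hkc'
      exact contDiff_const.mul
        ((hc.comp (contDiff_id.add contDiff_const)).sub (hc.comp (contDiff_id.sub contDiff_const)))
    · rw [Real.fourier_mul_convolution_eq hbox hk, fourier_box, hkF]
      ring

lemma one_sub_cos_one_le_sin_sq_add (u : ℝ) :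
    1 - Real.cos 1 ≤ Real.sin u ^ 2 + Real.sin (u + 1) ^ 2 := by
  have h : Real.sin u ^ 2 + Real.sin (u + 1) ^ 2 = 1 - Real.cos (2 * u + 1) * Real.cos 1 := by
    have e1 : Real.sin u ^ 2 = 1 / 2 - Real.cos (2 * u) / 2 := Real.sin_sq_eq_half_sub u
    have e2 : Real.sin (u + 1) ^ 2 = 1 / 2 - Real.cos (2 * (u + 1)) / 2 :=
      Real.sin_sq_eq_half_sub (u + 1)
    have e3 := Real.cos_sub (2 * u + 1) 1
    have e4 := Real.cos_add (2 * u + 1) 1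
    rw [show 2 * u + 1 - 1 = 2 * u by ring] at e3
    rw [show 2 * u + 1 + 1 = 2 * (u + 1) by ring] at e4
    rw [e1, e2, e3, e4]
    ring
  have := Real.cos_le_one (2 * u + 1)
  have := Real.cos_one_pos
  nlinarith

lemma abs_sinc_mul_le (u : ℝ) : |Real.sinc u| * (1 + |u|) ≤ 2 := by
  by_cases hu : u = 0
  · simp [hu]
  have h1 := Real.abs_sinc_le_one u
  have h2 : |Real.sinc u| * |u| ≤ 1 := by
    rw [Real.sinc_of_ne_zero hu, abs_div, div_mul_cancel₀ _ (abs_ne_zero.2 hu)]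
    exact Real.abs_sin_le_one u
  linarith

lemma abs_sin_le_abs_sinc_mul (u : ℝ) : |Real.sin u| ≤ |Real.sinc u| * (1 + |u|) := by
  by_cases hu : u = 0
  · simp [hu]
  have h2 : |Real.sinc u| * |u| = |Real.sin u| := by
    rw [Real.sinc_of_ne_zero hu, abs_div, div_mul_cancel₀ _ (abs_ne_zero.2 hu)]
  nlinarith [abs_nonneg (Real.sinc u)]

/-- For every exponent there is a positive kernel `K` of exact polynomial decay at least of that
order whose Fourier transform is `C¹` with compact support. The kernel is
`sinc u ^ p + sinc (u + 1) ^ p` with `p` even: the two summands have no common zero. -/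
lemma exists_kernel (q : ℕ) :
    ∃ (p : ℕ) (K : ℝ → ℝ) (k : ℝ → ℂ) (c C : ℝ), q ≤ p ∧ 0 < c ∧ 0 < C ∧ Continuous K ∧
      ContDiff ℝ 1 k ∧ HasCompactSupport k ∧
      (∀ u : ℝ, c / (1 + |u|) ^ p ≤ K u) ∧ (∀ u : ℝ, K u ≤ C / (1 + |u|) ^ p) ∧
      ∀ u : ℝ, (K u : ℂ) = ∫ y, k y * Complex.exp (Complex.I * u * y) := by
  obtain ⟨k, hk, hks, -, hkd, hkF⟩ := exists_fourier_eq_sinc_pow (2 * (q + 1) + 1)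
  have hkF' : ∀ u : ℝ, ∫ y, k y * Complex.exp (Complex.I * u * y) =
      (Real.sinc u : ℂ) ^ (2 * (q + 2)) := by
    intro u
    have := hkF (-(u / (2 * Real.pi)))
    rw [Real.fourier_real_eq_integral_exp_smul,
      show 2 * Real.pi * -(u / (2 * Real.pi)) = -u by field_simp, Real.sinc_neg] at this
    rw [show 2 * (q + 2) = 2 * (q + 1) + 1 + 1 by ring, ← this]
    refine integral_congr_ae (ae_of_all _ fun y => ?_)
    simp only [smul_eq_mul]
    rw [mul_comm, show -2 * Real.pi * y * -(u / (2 * Real.pi)) = u * y by field_simp]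
    push_cast
    ring_nf
  have hcos : 0 < 1 - Real.cos 1 := by
    have := Real.cos_one_le
    linarith
  have hpos : ∀ u : ℝ, 0 < 1 + |u| := fun u => by positivity
  refine ⟨2 * (q + 2), fun u => Real.sinc u ^ (2 * (q + 2)) + Real.sinc (u + 1) ^ (2 * (q + 2)),
    fun y => k y * (1 + Complex.exp (Complex.I * y)), ((1 - Real.cos 1) / 8) ^ (q + 2),
    2 ^ (2 * (q + 2)) + 4 ^ (2 * (q + 2)), by omega, by positivity, by positivity, ?_, ?_, ?_, ?_,
    ?_, ?_⟩
  · exact (Real.continuous_sinc.pow _).add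
      ((Real.continuous_sinc.comp (continuous_add_const 1)).pow _)
  · refine (hkd (by omega)).mul (contDiff_const.add ?_)
    exact (contDiff_const.mul Complex.ofRealCLM.contDiff).cexp
  · exact hks.mul_right
  · intro u
    rw [div_le_iff₀ (pow_pos (hpos u) _)]
    -- At every point one of the two sines is bounded away from zero; the factor `1 / 4` lost in the
    -- constant pays for replacing `1 + |u + 1|` by `1 + |u|`.
    have h0 : (1 - Real.cos 1) / 2 ≤ Real.sin u ^ 2 ∨
        (1 - Real.cos 1) / 2 ≤ Real.sin (u + 1) ^ 2 := by
      by_contra! h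
      linarith [one_sub_cos_one_le_sin_sq_add u]
    have hsq : ∀ v : ℝ, Real.sin v ^ 2 ≤ Real.sinc v ^ 2 * (1 + |v|) ^ 2 := by
      intro v
      rw [← sq_abs (Real.sin v), ← sq_abs (Real.sinc v), ← mul_pow]
      exact pow_le_pow_left₀ (abs_nonneg _) (abs_sin_le_abs_sinc_mul v) 2
    simp only [pow_mul _ 2 (q + 2)]
    rcases h0 with h | h
    · calc ((1 - Real.cos 1) / 8) ^ (q + 2)
          ≤ (Real.sinc u ^ 2 * (1 + |u|) ^ 2) ^ (q + 2) := by
            refine pow_le_pow_left₀ (by positivity) ?_ _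
            linarith [hsq u]
        _ = (Real.sinc u ^ 2) ^ (q + 2) * ((1 + |u|) ^ 2) ^ (q + 2) := mul_pow _ _ _
        _ ≤ _ := by
            refine mul_le_mul_of_nonneg_right ?_ (by positivity)
            linarith [show 0 ≤ (Real.sinc (u + 1) ^ 2) ^ (q + 2) by positivity]
    · have h4 : (1 + |u + 1|) ^ 2 ≤ 4 * (1 + |u|) ^ 2 := by
        rw [show (4 : ℝ) * (1 + |u|) ^ 2 = (2 * (1 + |u|)) ^ 2 by ring]
        refine pow_le_pow_left₀ (by positivity) ?_ 2
        have := abs_add_le u 1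
        rw [abs_one] at this
        linarith [abs_nonneg u]
      calc ((1 - Real.cos 1) / 8) ^ (q + 2)
          ≤ (Real.sinc (u + 1) ^ 2 * (1 + |u|) ^ 2) ^ (q + 2) := by
            refine pow_le_pow_left₀ (by positivity) ?_ _
            nlinarith [hsq (u + 1), sq_nonneg (Real.sinc (u + 1))]
        _ = (Real.sinc (u + 1) ^ 2) ^ (q + 2) * ((1 + |u|) ^ 2) ^ (q + 2) := mul_pow _ _ _
        _ ≤ _ := by
            refine mul_le_mul_of_nonneg_right ?_ (by positivity)
            linarith [show 0 ≤ (Real.sinc u ^ 2) ^ (q + 2) by positivity]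
  · intro u
    rw [le_div_iff₀ (pow_pos (hpos u) _), add_mul]
    have e1 : ∀ v b : ℝ, |Real.sinc v| * (1 + |u|) ≤ b →
        Real.sinc v ^ (2 * (q + 2)) * (1 + |u|) ^ (2 * (q + 2)) ≤ b ^ (2 * (q + 2)) := by
      intro v b hb
      rw [← (even_two_mul (q + 2)).pow_abs, ← mul_pow]
      exact pow_le_pow_left₀ (by positivity) hb _
    refine add_le_add (e1 _ _ (abs_sinc_mul_le u)) (e1 _ _ ?_)
    have h1 := abs_sinc_mul_le (u + 1)
    have h2 : 1 + |u| ≤ 2 * (1 + |u + 1|) := by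
      have := abs_sub (u + 1) 1
      rw [add_sub_cancel_right, abs_one] at this
      linarith [abs_nonneg (u + 1)]
    nlinarith [abs_nonneg (Real.sinc (u + 1))]
  · intro u
    have hint : ∀ v : ℝ, Integrable fun y : ℝ => k y * Complex.exp (Complex.I * v * y) := by
      intro v
      refine hk.mul_bdd (c := 1) (by fun_prop) (ae_of_all _ fun y => ?_)
      rw [show Complex.I * v * y = ((v * y : ℝ) : ℂ) * Complex.I by push_cast; ring,
        Complex.norm_exp_ofReal_mul_I]
    push_cast
    rw [← hkF' u, ← hkF' (u + 1),
      ← integral_add (hint u) (hint (u + 1))]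
    refine integral_congr_ae (ae_of_all _ fun y => ?_)
    simp only
    rw [show Complex.I * ((u + 1 : ℝ) : ℂ) * y = Complex.I * u * y + Complex.I * y by
      push_cast; ring, Complex.exp_add]
    ring

/-! ### Laplace transforms, Fubini and integration by parts -/

/-- The measure `t ^ (r - 1) dt` on the positive half-line, whose Laplace transform is
`Γ(r) z ^ (-r)`. -/
noncomputable def powMeasure (r : ℝ) : Measure ℝ :=
  (volume.restrict (Set.Ioi 0)).withDensity fun t => ENNReal.ofReal (t ^ (r - 1))

lemma integral_powMeasure (r : ℝ) (f : ℝ → ℂ) :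
    ∫ t, f t ∂(powMeasure r) = ∫ t in Set.Ioi (0 : ℝ), ((t ^ (r - 1) : ℝ) : ℂ) * f t := by
  rw [powMeasure, integral_withDensity_eq_integral_toReal_smul (by fun_prop)
    (ae_of_all _ fun _ => ENNReal.ofReal_lt_top)]
  refine setIntegral_congr_fun measurableSet_Ioi fun t ht => ?_
  rw [ENNReal.toReal_ofReal (Real.rpow_nonneg (le_of_lt ht) _), Complex.real_smul]

lemma integrable_powMeasure_iff (r : ℝ) {E : Type*} [NormedAddCommGroup E] [NormedSpace ℝ E]
    (f : ℝ → E) :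
    Integrable f (powMeasure r) ↔
      IntegrableOn (fun t => t ^ (r - 1) • f t) (Set.Ioi (0 : ℝ)) := by
  rw [powMeasure, integrable_withDensity_iff_integrable_smul' (by fun_prop)
    (ae_of_all _ fun _ => ENNReal.ofReal_lt_top)]
  refine integrableOn_congr_fun (fun t ht => ?_) measurableSet_Ioi
  rw [ENNReal.toReal_ofReal (Real.rpow_nonneg (le_of_lt ht) _)]

instance (r : ℝ) : SFinite (powMeasure r) := by
  unfold powMeasure
  infer_instance

lemma integrable_exp_powMeasure {r ε : ℝ} (hr : 0 < r) (hε : 0 < ε) :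
    Integrable (fun t : ℝ => Real.exp (-(ε * t))) (powMeasure r) := by
  rw [integrable_powMeasure_iff]
  have := integrableOn_rpow_mul_exp_neg_mul_rpow (s := r - 1) (p := 1) (b := ε)
    (by linarith) (by norm_num) hε
  refine this.congr_fun (fun t _ => ?_) measurableSet_Ioi
  simp

open ProbabilityTheory in
/-- The formula holds on the positive reals by the definition of the Gamma function, and on the
right half-plane by analytic continuation. -/
lemma laplace_powMeasure {r : ℝ} (hr : 0 < r) {z : ℂ} (hz : 0 < z.re) :
    ∫ t : ℝ, Complex.exp (-(z * t)) ∂(powMeasure r) =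
      (Real.Gamma r : ℂ) * z ^ (-(r : ℂ)) := by
  have hint : ∀ z : ℂ, 0 < z.re →
      (-z).re ∈ interior (integrableExpSet id (powMeasure r)) := by
    intro z hz
    have hsub : Set.Iio (0 : ℝ) ⊆ integrableExpSet id (powMeasure r) := by
      intro t ht
      have := integrable_exp_powMeasure hr (neg_pos.2 ht)
      simpa [integrableExpSet] using this
    refine interior_mono hsub ?_
    rw [interior_Iio]
    simpa using hz
  have hopen : IsPreconnected {z : ℂ | 0 < z.re} := (convex_halfSpace_re_gt 0).isPreconnected
  have hA : AnalyticOnNhd ℂ (fun z : ℂ => complexMGF id (powMeasure r) (-z))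
      {z : ℂ | 0 < z.re} := by
    intro z hz
    exact (analyticAt_complexMGF (hint z hz)).fun_comp analyticAt_id.neg
  have hB : AnalyticOnNhd ℂ (fun z : ℂ => (Real.Gamma r : ℂ) * z ^ (-(r : ℂ)))
      {z : ℂ | 0 < z.re} := by
    intro z hz
    exact analyticAt_const.mul (analyticAt_id.cpow analyticAt_const (Or.inl hz))
  have hreal : ∀ x : ℝ, 0 < x → complexMGF id (powMeasure r) (-(x : ℂ)) =
      (Real.Gamma r : ℂ) * (x : ℂ) ^ (-(r : ℂ)) := by
    intro x hx
    have h1 := Complex.integral_cpow_mul_exp_neg_mul_Ioi (a := r) (r := x) (by simpa using hr) hx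
    rw [complexMGF, integral_powMeasure]
    rw [Complex.Gamma_ofReal, one_div, Complex.inv_cpow _ _ (by
      rw [Complex.arg_ofReal_of_nonneg hx.le]; exact Real.pi_pos.ne), ← Complex.cpow_neg,
      mul_comm] at h1
    rw [← h1]
    refine setIntegral_congr_fun measurableSet_Ioi fun t ht => ?_
    simp only [id]
    rw [Complex.ofReal_cpow (le_of_lt ht)]
    push_cast
    rw [neg_mul]
  have hfreq : ∃ᶠ z in 𝓝[≠] (1 : ℂ), complexMGF id (powMeasure r) (-z) =
      (Real.Gamma r : ℂ) * z ^ (-(r : ℂ)) := by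
    have htend : Tendsto (fun x : ℝ => (x : ℂ)) (𝓝[≠] 1) (𝓝[≠] (1 : ℂ)) := by
      refine tendsto_nhdsWithin_iff.2 ⟨?_, ?_⟩
      · have : Tendsto (fun x : ℝ => (x : ℂ)) (𝓝 1) (𝓝 ((1 : ℝ) : ℂ)) :=
          Complex.continuous_ofReal.tendsto 1
        rw [Complex.ofReal_one] at this
        exact this.mono_left nhdsWithin_le_nhds
      · filter_upwards [self_mem_nhdsWithin] with x hx
        simpa using hx
    refine htend.frequently (Eventually.frequently ?_)
    filter_upwards [nhdsWithin_le_nhds (Ioi_mem_nhds (zero_lt_one' ℝ))] with x hx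
    exact hreal x hx
  have := hA.eqOn_of_preconnected_of_frequently_eq hB hopen (z₀ := 1) (by simp) hfreq hz
  simp only at this
  rw [← this, complexMGF]
  simp only [id, neg_mul]

/-- Fubini: pairing a damped measure with a Fourier transform is integrating its Laplace transform
along a vertical line. -/
lemma integral_fourier_mul_exp {μ : Measure ℝ} [SFinite μ] {k K : ℝ → ℂ} (hk : Integrable k)
    (hK : ∀ u : ℝ, K u = ∫ y, k y * Complex.exp (Complex.I * u * y)) {ε : ℝ} (x : ℝ)
    (hμ : Integrable (fun t : ℝ => Real.exp (-(ε * t))) μ) :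
    ∫ t : ℝ, K (t - x) * (Real.exp (-(ε * t)) : ℂ) ∂μ =
      ∫ y : ℝ, k y * Complex.exp (-(Complex.I * x * y)) *
        ∫ t : ℝ, Complex.exp (-((ε - Complex.I * y) * t)) ∂μ := by
  have hint : Integrable (Function.uncurry fun (t y : ℝ) =>
      k y * Complex.exp (Complex.I * (t - x) * y) * (Real.exp (-(ε * t)) : ℂ))
      (μ.prod volume) := by
    have h1 := hμ.ofReal (𝕜 := ℂ) |>.mul_prod hk
    have h2 := h1.mul_bdd (c := 1)
      (g := fun p : ℝ × ℝ => Complex.exp (Complex.I * (p.1 - x) * p.2))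
      (by fun_prop) (ae_of_all _ fun p => by
        rw [show Complex.I * ((p.1 : ℂ) - x) * p.2 = (((p.1 - x) * p.2 : ℝ) : ℂ) * Complex.I by
          push_cast; ring, Complex.norm_exp_ofReal_mul_I])
    refine h2.congr (ae_of_all _ fun p => ?_)
    simp only [Function.uncurry]
    simp only [Complex.coe_algebraMap]
    ring
  calc ∫ t : ℝ, K (t - x) * (Real.exp (-(ε * t)) : ℂ) ∂μ
      = ∫ t : ℝ, (∫ y : ℝ, k y * Complex.exp (Complex.I * (t - x) * y) *
          (Real.exp (-(ε * t)) : ℂ)) ∂μ := by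
        refine integral_congr_ae (ae_of_all _ fun t => ?_)
        simp only
        rw [hK, ← integral_mul_const]
        push_cast
        rfl
    _ = ∫ y : ℝ, ∫ t : ℝ, k y * Complex.exp (Complex.I * (t - x) * y) *
          (Real.exp (-(ε * t)) : ℂ) ∂μ := integral_integral_swap hint
    _ = _ := by
        refine integral_congr_ae (ae_of_all _ fun y => ?_)
        simp only
        rw [← integral_const_mul]
        refine integral_congr_ae (ae_of_all _ fun t => ?_)
        simp only
        push_cast
        rw [mul_assoc, mul_assoc (k y), ← Complex.exp_add, ← Complex.exp_add]
        congr 2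
        ring

/-- One integration by parts. -/
lemma norm_fourier_le_of_contDiff {u : ℝ → ℂ} (hu : ContDiff ℝ 1 u) (hs : HasCompactSupport u)
    {x : ℝ} (hx : 0 < x) :
    ‖∫ y : ℝ, u y * Complex.exp (-(Complex.I * x * y))‖ ≤ (∫ y : ℝ, ‖deriv u y‖) / x := by
  have hx' : (x : ℂ) ≠ 0 := by exact_mod_cast hx.ne'
  have hIx : -(Complex.I * x) ≠ 0 := by simp [hx']
  have hud : Continuous (deriv u) := hu.continuous_deriv le_rfl
  have hus : HasCompactSupport (deriv u) := hs.deriv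
  have hnorm : ∀ y : ℝ, ‖Complex.exp (-(Complex.I * x * y))‖ = 1 := fun y => by
    rw [show -(Complex.I * x * y) = ((-(x * y) : ℝ) : ℂ) * Complex.I by push_cast; ring,
      Complex.norm_exp_ofReal_mul_I]
  have hv : ∀ y : ℝ, HasDerivAt (fun y : ℝ => Complex.exp (-(Complex.I * x * y)) /
      -(Complex.I * x)) (Complex.exp (-(Complex.I * x * y))) y := by
    intro y
    have h1 : HasDerivAt (fun y : ℝ => -(Complex.I * x * (y : ℂ))) (-(Complex.I * x)) y := by
      have := ((Complex.ofRealCLM.hasDerivAt (x := y)).const_mul (Complex.I * x)).neg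
      simpa [Pi.neg_def] using this
    have h2 := h1.cexp.div_const (-(Complex.I * x))
    rwa [mul_div_cancel_right₀ _ hIx] at h2
  have hint : ∀ w v : ℝ → ℂ, Continuous w → HasCompactSupport w → Continuous v →
      Integrable (w * v) := fun w v hw hws hv =>
    (hw.mul hv).integrable_of_hasCompactSupport hws.mul_right
  have := integral_mul_deriv_eq_deriv_mul_of_integrable (u := u) (u' := deriv u)
    (v := fun y : ℝ => Complex.exp (-(Complex.I * x * y)) / -(Complex.I * x))
    (v' := fun y : ℝ => Complex.exp (-(Complex.I * x * y)))
    (fun y _ => (hu.differentiable one_ne_zero y).hasDerivAt) (fun y _ => hv y)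
    (hint _ _ hu.continuous hs (by fun_prop)) (hint _ _ hud hus (by fun_prop))
    (hint _ _ hu.continuous hs (by fun_prop))
  rw [this, norm_neg]
  calc ‖∫ y : ℝ, deriv u y * (Complex.exp (-(Complex.I * x * y)) / -(Complex.I * x))‖
      ≤ ∫ y : ℝ, ‖deriv u y‖ / x := by
        refine norm_integral_le_of_norm_le ((hud.integrable_of_hasCompactSupport hus).norm.div_const x)
          (ae_of_all _ fun y => ?_)
        rw [norm_mul, norm_div, hnorm, norm_neg, norm_mul, Complex.norm_I, one_mul,
          Complex.norm_real, Real.norm_of_nonneg hx.le, mul_one_div]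
    _ = _ := integral_div _ _

/-! ### Mild boundary behaviour -/

/-- A function on the right half-plane is mild at the boundary point `i y` if near that point it is
holomorphic and bounded, with derivative `O(|z - i y| ^ (-β))`. For `β < 1` this bound is integrable
along vertical lines, uniformly in their distance to the boundary. No boundary values are
required to exist. -/
def MildAt (β : ℝ) (R : ℂ → ℂ) (y : ℝ) : Prop :=
  ∃ δ > 0, ∃ C : ℝ, ∀ z : ℂ, 0 < z.re → ‖z - Complex.I * y‖ < δ →
    DifferentiableAt ℂ R z ∧ ‖R z‖ ≤ C ∧ ‖deriv R z‖ ≤ C * ‖z - Complex.I * y‖ ^ (-β)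

lemma integrable_indicator_abs_rpow {β : ℝ} (hβ : β < 1) (C y₀ : ℝ) :
    Integrable ((Set.Ioo (y₀ - 1) (y₀ + 1)).indicator fun y : ℝ => C * (1 + |y - y₀| ^ (-β))) := by
  have h1 : LocallyIntegrable (fun y : ℝ => |y| ^ (-β)) := by
    refine locallyIntegrable_of_norm_le_rpow (C := 1) (α := β) (by simp) (by simpa using hβ)
      (ae_of_all _ fun y => ?_)
      (measurable_id.abs.pow_const _).aestronglyMeasurable
    rw [Real.norm_of_nonneg (by positivity), one_mul, Real.norm_eq_abs]
  have h2 : IntegrableOn (fun y : ℝ => |y| ^ (-β)) (Set.Ioo (-1) 1) :=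
    (h1.integrableOn_isCompact isCompact_Icc).mono_set Set.Ioo_subset_Icc_self
  have h3 : Integrable ((Set.Ioo (-1 : ℝ) 1).indicator fun y : ℝ => C * (1 + |y| ^ (-β))) := by
    rw [integrable_indicator_iff measurableSet_Ioo]
    exact ((integrableOn_const (by simp) (by simp)).add h2).const_mul C
  refine (h3.comp_sub_right y₀).congr (ae_of_all _ fun y => ?_)
  by_cases hy : y ∈ Set.Ioo (y₀ - 1) (y₀ + 1)
  · have hy' : y - y₀ ∈ Set.Ioo (-1 : ℝ) 1 := ⟨by linarith [hy.1], by linarith [hy.2]⟩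
    simp only [hy, hy', Set.indicator_of_mem]
  · have hy' : y - y₀ ∉ Set.Ioo (-1 : ℝ) 1 := fun h => hy ⟨by linarith [h.1], by linarith [h.2]⟩
    simp only [hy, hy', Set.indicator_of_notMem, not_false_eq_true]

/-- A function mild along the whole imaginary axis is, together with its derivative, dominated on
vertical segments near the axis by one integrable function. -/
lemma exists_integrable_bound_of_mildAt {β : ℝ} (hβ0 : 0 ≤ β) (hβ : β < 1) {R : ℂ → ℂ}
    (hR : ∀ y : ℝ, MildAt β R y) (T : ℝ) :
    ∃ δ > 0, ∃ G : ℝ → ℝ, Integrable G ∧ (∀ y, 0 ≤ G y) ∧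
      ∀ᵐ y : ℝ, y ∈ Set.Icc (-T) T → ∀ ε : ℝ, 0 < ε → ε < δ →
        ‖R (ε - Complex.I * y)‖ ≤ G y ∧ ‖deriv R (ε - Complex.I * y)‖ ≤ G y := by
  refine isCompact_Icc.induction_on (p := fun S : Set ℝ => ∃ δ > 0, ∃ G : ℝ → ℝ, Integrable G ∧
      (∀ y, 0 ≤ G y) ∧ ∀ᵐ y : ℝ, y ∈ S → ∀ ε : ℝ, 0 < ε → ε < δ →
        ‖R (ε - Complex.I * y)‖ ≤ G y ∧ ‖deriv R (ε - Complex.I * y)‖ ≤ G y)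
    ⟨1, one_pos, 0, integrable_zero _ _ _, fun _ => le_rfl, by simp⟩ ?_ ?_ ?_
  · rintro s t hst ⟨δ, hδ, G, hG, hG0, h⟩
    exact ⟨δ, hδ, G, hG, hG0, h.mono fun y hy hys => hy (hst hys)⟩
  · rintro s t ⟨δ, hδ, G, hG, hG0, h⟩ ⟨δ', hδ', G', hG', hG0', h'⟩
    refine ⟨min δ δ', lt_min hδ hδ', G + G', hG.add hG', fun y => add_nonneg (hG0 y) (hG0' y), ?_⟩
    filter_upwards [h, h'] with y hy hy' hyst ε hε hεδ
    have := hG0 y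
    have := hG0' y
    simp only [Pi.add_apply]
    rcases hyst with hys | hyt
    · have := hy hys ε hε (hεδ.trans_le (min_le_left _ _))
      exact ⟨by linarith [this.1], by linarith [this.2]⟩
    · have := hy' hyt ε hε (hεδ.trans_le (min_le_right _ _))
      exact ⟨by linarith [this.1], by linarith [this.2]⟩
  · intro y₀ _
    obtain ⟨δ, hδ, C, hC⟩ := hR (-y₀)
    have hr : 0 < min (δ / 2) 1 := by positivity
    refine ⟨Set.Ioo (y₀ - min (δ / 2) 1) (y₀ + min (δ / 2) 1),
      mem_nhdsWithin_of_mem_nhds (Ioo_mem_nhds (by linarith) (by linarith)), δ / 2, by positivity,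
      _, integrable_indicator_abs_rpow hβ |C| y₀, fun y => ?_, ?_⟩
    · refine Set.indicator_nonneg (fun y _ => ?_) y
      positivity
    · have hne : ∀ᵐ y : ℝ, y ≠ y₀ := by simp [ae_iff, measure_singleton]
      filter_upwards [hne] with y hy hyS ε hε hεδ
      have hyS' : y ∈ Set.Ioo (y₀ - 1) (y₀ + 1) :=
        ⟨by linarith [hyS.1, min_le_right (δ / 2) 1], by linarith [hyS.2, min_le_right (δ / 2) 1]⟩
      rw [Set.indicator_of_mem hyS']
      have hyd : |y - y₀| < δ / 2 := by
        rw [abs_lt]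
        constructor <;> linarith [hyS.1, hyS.2, min_le_left (δ / 2) 1]
      have hpos : 0 < |y - y₀| := abs_pos.2 (sub_ne_zero.2 hy)
      have he : (ε - Complex.I * y : ℂ) - Complex.I * ((-y₀ : ℝ) : ℂ) =
          ε - Complex.I * ((y - y₀ : ℝ) : ℂ) := by
        push_cast
        ring
      have hre : 0 < (ε - Complex.I * y : ℂ).re := by simpa using hε
      have hup : ‖(ε - Complex.I * y : ℂ) - Complex.I * ((-y₀ : ℝ) : ℂ)‖ < δ := by
        rw [he]
        refine (norm_sub_le _ _).trans_lt ?_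
        rw [norm_mul, Complex.norm_I, one_mul, Complex.norm_real, Complex.norm_real,
          Real.norm_of_nonneg hε.le, Real.norm_eq_abs]
        linarith
      have hlow : |y - y₀| ≤ ‖(ε - Complex.I * y : ℂ) - Complex.I * ((-y₀ : ℝ) : ℂ)‖ := by
        rw [he]
        have := Complex.abs_im_le_norm (ε - Complex.I * ((y - y₀ : ℝ) : ℂ))
        simpa [abs_sub_comm] using this
      obtain ⟨-, h1, h2⟩ := hC _ hre hup
      have hpow : 0 ≤ |y - y₀| ^ (-β) := by positivity
      have hmono : ‖(ε - Complex.I * y : ℂ) - Complex.I * ((-y₀ : ℝ) : ℂ)‖ ^ (-β) ≤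
          |y - y₀| ^ (-β) := Real.rpow_le_rpow_of_nonpos hpos hlow (by linarith)
      constructor
      · calc _ ≤ C := h1
          _ ≤ |C| := le_abs_self C
          _ ≤ |C| * (1 + |y - y₀| ^ (-β)) := by nlinarith [abs_nonneg C]
      · calc _ ≤ _ := h2
          _ ≤ |C| * ‖(ε - Complex.I * y : ℂ) - Complex.I * ((-y₀ : ℝ) : ℂ)‖ ^ (-β) := by
            gcongr
            exact le_abs_self C
          _ ≤ |C| * (1 + |y - y₀| ^ (-β)) := by
            gcongr
            linarith

/-- Integration by parts gives decay `O(1 / x)` of the oscillatory integrals of a mild function,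
uniformly as the line of integration approaches the boundary. -/
lemma exists_oscillatory_bound_of_mildAt {β : ℝ} (hβ0 : 0 ≤ β) (hβ : β < 1) {R : ℂ → ℂ}
    (hR : ∀ y : ℝ, MildAt β R y) (hRd : ∀ z : ℂ, 0 < z.re → ContDiffAt ℂ 1 R z)
    {k : ℝ → ℂ} (hk : ContDiff ℝ 1 k) (hks : HasCompactSupport k) :
    ∃ δ > 0, ∃ B : ℝ, ∀ ε x : ℝ, 0 < ε → ε < δ → 0 < x →
      ‖∫ y : ℝ, k y * Complex.exp (-(Complex.I * x * y)) * R (ε - Complex.I * y)‖ ≤ B / x := by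
  have hkd : Continuous (deriv k) := hk.continuous_deriv le_rfl
  obtain ⟨M₁, hM₁⟩ := hks.exists_bound_of_continuous hk.continuous
  obtain ⟨M₂, hM₂⟩ := hks.deriv.exists_bound_of_continuous hkd
  obtain ⟨T, hT⟩ := hks.isCompact.isBounded.subset_closedBall 0
  rw [Real.closedBall_eq_Icc, zero_sub, zero_add] at hT
  obtain ⟨δ, hδ, G, hG, hG0, hb⟩ := exists_integrable_bound_of_mildAt hβ0 hβ hR T
  refine ⟨δ, hδ, ∫ y, (M₁ + M₂) * G y, fun ε x hε hεδ hx => ?_⟩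
  have hre : ∀ y : ℝ, 0 < (ε - Complex.I * y : ℂ).re := fun y => by simpa using hε
  have hline : ContDiff ℝ 1 fun y : ℝ => (ε - Complex.I * y : ℂ) :=
    contDiff_const.sub (contDiff_const.mul Complex.ofRealCLM.contDiff)
  have hRl : ContDiff ℝ 1 fun y : ℝ => R (ε - Complex.I * y) :=
    contDiff_iff_contDiffAt.2 fun y =>
      ((hRd _ (hre y)).restrict_scalars ℝ).comp y hline.contDiffAt
  have hlined : ∀ y : ℝ, HasDerivAt (fun y : ℝ => (ε - Complex.I * y : ℂ)) (-Complex.I) y := by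
    intro y
    have := ((Complex.ofRealCLM.hasDerivAt (x := y)).const_mul Complex.I).const_sub (ε : ℂ)
    simpa using this
  have hRld : ∀ y : ℝ, HasDerivAt (fun y : ℝ => R (ε - Complex.I * y))
      (deriv R (ε - Complex.I * y) * -Complex.I) y := fun y =>
    HasDerivAt.comp (𝕜 := ℝ) (𝕜' := ℂ) y
      ((hRd _ (hre y)).differentiableAt one_ne_zero).hasDerivAt (hlined y)
  have hu : ContDiff ℝ 1 fun y : ℝ => k y * R (ε - Complex.I * y) := hk.mul hRl
  have hus : HasCompactSupport fun y : ℝ => k y * R (ε - Complex.I * y) := hks.mul_right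
  have h1 := norm_fourier_le_of_contDiff hu hus hx
  have e1 : ∀ y : ℝ, k y * Complex.exp (-(Complex.I * x * y)) * R (ε - Complex.I * y) =
      k y * R (ε - Complex.I * y) * Complex.exp (-(Complex.I * x * y)) := fun y => by ring
  simp_rw [e1]
  refine h1.trans (div_le_div_of_nonneg_right ?_ hx.le)
  refine integral_mono_ae
    ((hu.continuous_deriv le_rfl).integrable_of_hasCompactSupport hus.deriv).norm
    (hG.const_mul _) ?_
  filter_upwards [hb] with y hy
  have hM₁' : 0 ≤ M₁ := (norm_nonneg _).trans (hM₁ y)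
  have hM₂' : 0 ≤ M₂ := (norm_nonneg _).trans (hM₂ y)
  have hd : deriv (fun y : ℝ => k y * R (ε - Complex.I * y)) y =
      deriv k y * R (ε - Complex.I * y) + k y * (deriv R (ε - Complex.I * y) * -Complex.I) :=
    ((hk.differentiable one_ne_zero y).hasDerivAt.mul (hRld y)).deriv
  by_cases hyT : y ∈ Set.Icc (-T) T
  · obtain ⟨hy1, hy2⟩ := hy hyT ε hε hεδ
    rw [hd]
    calc _ ≤ ‖deriv k y * R (ε - Complex.I * y)‖ +
          ‖k y * (deriv R (ε - Complex.I * y) * -Complex.I)‖ := norm_add_le _ _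
      _ = ‖deriv k y‖ * ‖R (ε - Complex.I * y)‖ + ‖k y‖ * ‖deriv R (ε - Complex.I * y)‖ := by
          simp
      _ ≤ M₂ * G y + M₁ * G y :=
          add_le_add (mul_le_mul (hM₂ y) hy1 (norm_nonneg _) hM₂')
            (mul_le_mul (hM₁ y) hy2 (norm_nonneg _) hM₁')
      _ = (M₁ + M₂) * G y := by ring
  · have hy0 : y ∉ tsupport fun y : ℝ => k y * R (ε - Complex.I * y) := fun h =>
      hyT (hT (closure_mono (Function.support_mul_subset_left _ _) h))
    have : deriv (fun y : ℝ => k y * R (ε - Complex.I * y)) y = 0 := by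
      by_contra hne
      exact hy0 (support_deriv_subset hne)
    simp only [this, norm_zero]
    exact mul_nonneg (by linarith) (hG0 y)

/-! ### Comparison with the model measures -/

lemma ae_pos_powMeasure (r : ℝ) : ∀ᵐ t ∂(powMeasure r), 0 < t :=
  (withDensity_absolutelyContinuous _ _).ae_le (ae_restrict_mem measurableSet_Ioi)

lemma tendsto_integral_mul_exp {μ : Measure ℝ} (hμ : ∀ᵐ t ∂μ, 0 ≤ t) {f : ℝ → ℂ}
    (hf : Integrable f μ) :
    Tendsto (fun ε : ℝ => ∫ t, f t * (Real.exp (-(ε * t)) : ℂ) ∂μ) (𝓝[>] 0)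
      (𝓝 (∫ t, f t ∂μ)) := by
  refine tendsto_integral_filter_of_dominated_convergence (fun t => ‖f t‖)
    (Eventually.of_forall fun ε => hf.aestronglyMeasurable.mul (by fun_prop)) ?_ hf.norm
    (ae_of_all _ fun t => ?_)
  · filter_upwards [self_mem_nhdsWithin] with ε hε
    filter_upwards [hμ] with t ht
    have hε' : (0 : ℝ) < ε := hε
    rw [norm_mul, Complex.norm_real, Real.norm_of_nonneg (Real.exp_pos _).le]
    refine mul_le_of_le_one_right (norm_nonneg _) (Real.exp_le_one_iff.2 ?_)
    nlinarith
  · have h : Continuous fun ε : ℝ => f t * (Real.exp (-(ε * t)) : ℂ) := by fun_prop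
    have := (h.tendsto 0).mono_left (nhdsWithin_le_nhds (s := Set.Ioi 0))
    simpa using this

lemma integrable_one_add_abs_powMeasure {r : ℝ} (hr : 0 < r) {p : ℕ} (hp : r < p) {x : ℝ}
    (hx : 0 ≤ x) : Integrable (fun t : ℝ => 1 / (1 + |t - x|) ^ p) (powMeasure r) := by
  have hpos : ∀ t : ℝ, 0 < 1 + |t - x| := fun t => by positivity
  have hcont : Continuous fun t : ℝ => 1 / (1 + |t - x|) ^ p :=
    continuous_const.div (by fun_prop) fun t => (pow_pos (hpos t) p).ne'
  rw [integrable_powMeasure_iff]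
  have hmeas : ∀ S : Set ℝ, AEStronglyMeasurable (fun t : ℝ => t ^ (r - 1) • (1 / (1 + |t - x|) ^ p))
      (volume.restrict S) := fun S =>
    ((measurable_id.pow_const (r - 1)).smul hcont.measurable).aestronglyMeasurable
  rw [← Set.Ioc_union_Ioi_eq_Ioi zero_le_one]
  refine IntegrableOn.union ?_ ?_
  · have h1 : IntegrableOn (fun t : ℝ => t ^ (r - 1)) (Set.Ioc 0 1) := by
      rw [← intervalIntegrable_iff_integrableOn_Ioc_of_le zero_le_one]
      exact intervalIntegral.intervalIntegrable_rpow' (by linarith)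
    refine Integrable.mono' h1 (hmeas _) ?_
    filter_upwards [ae_restrict_mem measurableSet_Ioc] with t ht
    have h0 : 0 ≤ t ^ (r - 1) := Real.rpow_nonneg ht.1.le _
    rw [smul_eq_mul, norm_mul, Real.norm_of_nonneg h0,
      Real.norm_of_nonneg (by positivity : 0 ≤ 1 / (1 + |t - x|) ^ p)]
    refine mul_le_of_le_one_right h0 ?_
    rw [div_le_one (pow_pos (hpos t) p)]
    exact one_le_pow₀ (by linarith [abs_nonneg (t - x)])
  · have h1 : IntegrableOn (fun t : ℝ => (1 + x) ^ p * t ^ (r - 1 - p)) (Set.Ioi 1) :=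
      (integrableOn_Ioi_rpow_of_lt (by linarith) one_pos).const_mul _
    refine Integrable.mono' h1 (hmeas _) ?_
    filter_upwards [ae_restrict_mem measurableSet_Ioi] with t ht
    have ht1 : (1 : ℝ) < t := ht
    have ht0 : 0 < t := by linarith
    have h0 : 0 ≤ t ^ (r - 1) := Real.rpow_nonneg ht0.le _
    rw [smul_eq_mul, norm_mul, Real.norm_of_nonneg h0,
      Real.norm_of_nonneg (by positivity : 0 ≤ 1 / (1 + |t - x|) ^ p),
      Real.rpow_sub ht0 (r - 1) p, Real.rpow_natCast, mul_div_assoc', mul_div_assoc', mul_one,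
      div_le_div_iff₀ (pow_pos (hpos t) p) (pow_pos ht0 p)]
    have h2 : t ≤ (1 + x) * (1 + |t - x|) := by
      have := le_abs_self (t - x)
      have := abs_nonneg (t - x)
      nlinarith
    calc t ^ (r - 1) * t ^ p ≤ t ^ (r - 1) * ((1 + x) * (1 + |t - x|)) ^ p := by gcongr
      _ = _ := by rw [mul_pow]; ring

/-- If the Laplace transform of `ν` differs from that of a combination of the model measures
`powMeasure (r j)` by a mild function, the damped pairings of both sides with a test kernel agree
up to `O(1 / x)`, uniformly in the damping. -/
lemma exists_damped_comparison {ν : Measure ℝ} [SFinite ν]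
    (hν : ∀ ε : ℝ, 0 < ε → Integrable (fun t : ℝ => Real.exp (-(ε * t))) ν)
    {s : Finset ℕ} {r : ℕ → ℝ} (hr : ∀ j ∈ s, 0 < r j) {b : ℕ → ℂ} {R : ℂ → ℂ}
    (hL : ∀ z : ℂ, 0 < z.re → ∫ t : ℝ, Complex.exp (-(z * t)) ∂ν =
      ∑ j ∈ s, b j * ∫ t : ℝ, Complex.exp (-(z * t)) ∂(powMeasure (r j)) + R z)
    {β : ℝ} (hβ0 : 0 ≤ β) (hβ : β < 1) (hR : ∀ y : ℝ, MildAt β R y)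
    (hRd : ∀ z : ℂ, 0 < z.re → ContDiffAt ℂ 1 R z)
    {k K : ℝ → ℂ} (hk : ContDiff ℝ 1 k) (hks : HasCompactSupport k)
    (hK : ∀ u : ℝ, K u = ∫ y, k y * Complex.exp (Complex.I * u * y)) :
    ∃ δ > 0, ∃ B : ℝ, ∀ ε x : ℝ, 0 < ε → ε < δ → 0 < x →
      ‖∫ t : ℝ, K (t - x) * (Real.exp (-(ε * t)) : ℂ) ∂ν -
        ∑ j ∈ s, b j * ∫ t : ℝ, K (t - x) * (Real.exp (-(ε * t)) : ℂ) ∂(powMeasure (r j))‖ ≤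
        B / x := by
  obtain ⟨δ, hδ, B, hB⟩ := exists_oscillatory_bound_of_mildAt hβ0 hβ hR hRd hk hks
  refine ⟨δ, hδ, B, fun ε x hε hεδ hx => ?_⟩
  have hki : Integrable k := hk.continuous.integrable_of_hasCompactSupport hks
  have hre : ∀ y : ℝ, 0 < (ε - Complex.I * y : ℂ).re := fun y => by simpa using hε
  have hint : ∀ g : ℝ → ℂ, Continuous g →
      Integrable fun y : ℝ => k y * Complex.exp (-(Complex.I * x * y)) * g y := fun g hg => by
    refine Continuous.integrable_of_hasCompactSupport ?_ hks.mul_right.mul_right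
    exact (hk.continuous.mul (by fun_prop)).mul hg
  have hRc : Continuous fun y : ℝ => R (ε - Complex.I * y) :=
    continuous_iff_continuousAt.2 fun y =>
      ContinuousAt.comp (f := fun y : ℝ => (ε - Complex.I * y : ℂ))
        (hRd _ (hre y)).continuousAt (by fun_prop)
  have hmodel : ∀ j ∈ s, Continuous fun y : ℝ =>
      ∫ t : ℝ, Complex.exp (-((ε - Complex.I * y) * t)) ∂(powMeasure (r j)) := by
    intro j hj
    simp_rw [fun y : ℝ => laplace_powMeasure (hr j hj) (hre y)]
    refine continuous_const.mul (Continuous.cpow (by fun_prop) continuous_const fun y => ?_)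
    exact Or.inl (hre y)
  have hsplit : ∫ t : ℝ, K (t - x) * (Real.exp (-(ε * t)) : ℂ) ∂ν -
        ∑ j ∈ s, b j * ∫ t : ℝ, K (t - x) * (Real.exp (-(ε * t)) : ℂ) ∂(powMeasure (r j)) =
      ∫ y : ℝ, k y * Complex.exp (-(Complex.I * x * y)) * R (ε - Complex.I * y) := by
    rw [integral_fourier_mul_exp hki hK x (hν ε hε), sub_eq_iff_eq_add']
    have h1 : ∀ j ∈ s, b j * ∫ t : ℝ, K (t - x) * (Real.exp (-(ε * t)) : ℂ) ∂(powMeasure (r j)) =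
        ∫ y : ℝ, b j * (k y * Complex.exp (-(Complex.I * x * y)) *
          ∫ t : ℝ, Complex.exp (-((ε - Complex.I * y) * t)) ∂(powMeasure (r j))) := fun j hj => by
      rw [integral_fourier_mul_exp hki hK x (integrable_exp_powMeasure (hr j hj) hε),
        integral_const_mul]
    rw [Finset.sum_congr rfl h1,
      ← integral_finsetSum _ fun j hj => (hint _ (hmodel j hj)).const_mul (b j),
      ← integral_add (integrable_finsetSum _ fun j hj => (hint _ (hmodel j hj)).const_mul (b j))
        (hint _ hRc)]
    refine integral_congr_ae (ae_of_all _ fun y => ?_)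
    simp only
    rw [hL _ (hre y), mul_add, Finset.mul_sum]
    congr 1
    exact Finset.sum_congr rfl fun j _ => by ring
  rw [hsplit]
  exact hB ε x hε hεδ hx

/-- Fatou's lemma removes the damping: a nonnegative test kernel is integrable against `ν`. -/
lemma integrable_kernel_of_damped_comparison {ν : Measure ℝ}
    (hν : ∀ ε : ℝ, 0 < ε → Integrable (fun t : ℝ => Real.exp (-(ε * t))) ν)
    {s : Finset ℕ} {r : ℕ → ℝ} {b : ℕ → ℂ} {K : ℝ → ℝ}
    (hKc : Continuous K) (hK0 : ∀ u, 0 ≤ K u) {M : ℝ} (hKM : ∀ u, K u ≤ M) {x : ℝ}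
    (hKi : ∀ j ∈ s, Integrable (fun t => K (t - x)) (powMeasure (r j)))
    {δ B : ℝ} (hδ : 0 < δ)
    (h : ∀ ε : ℝ, 0 < ε → ε < δ →
      ‖∫ t : ℝ, (K (t - x) : ℂ) * (Real.exp (-(ε * t)) : ℂ) ∂ν -
        ∑ j ∈ s, b j * ∫ t : ℝ, (K (t - x) : ℂ) * (Real.exp (-(ε * t)) : ℂ) ∂(powMeasure (r j))‖ ≤
        B) :
    Integrable (fun t => K (t - x)) ν := by
  set D : ℝ := B + ∑ j ∈ s, ‖b j‖ * ∫ t, K (t - x) ∂(powMeasure (r j)) with hD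
  have hdint : ∀ ε : ℝ, 0 < ε → Integrable (fun t : ℝ => K (t - x) * Real.exp (-(ε * t))) ν :=
    fun ε hε => (hν ε hε).bdd_mul (c := M) (by fun_prop) (ae_of_all _ fun t => by
      rw [Real.norm_of_nonneg (hK0 _)]
      exact hKM _)
  have hbound : ∀ ε : ℝ, 0 < ε → ε < δ → ∫ t : ℝ, K (t - x) * Real.exp (-(ε * t)) ∂ν ≤ D := by
    intro ε hε hεδ
    have h1 := h ε hε hεδ
    have e1 : ∫ t : ℝ, (K (t - x) : ℂ) * (Real.exp (-(ε * t)) : ℂ) ∂ν =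
        ((∫ t : ℝ, K (t - x) * Real.exp (-(ε * t)) ∂ν : ℝ) : ℂ) := by
      rw [← integral_complex_ofReal]
      exact integral_congr_ae (ae_of_all _ fun t => by push_cast; rfl)
    have h2 := (norm_sub_norm_le _ _).trans h1
    rw [e1, Complex.norm_real] at h2
    have h3 : ‖∑ j ∈ s, b j * ∫ t : ℝ, (K (t - x) : ℂ) * (Real.exp (-(ε * t)) : ℂ)
        ∂(powMeasure (r j))‖ ≤ ∑ j ∈ s, ‖b j‖ * ∫ t, K (t - x) ∂(powMeasure (r j)) := by
      refine norm_sum_le_of_le _ fun j hj => ?_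
      rw [norm_mul]
      refine mul_le_mul_of_nonneg_left (norm_integral_le_of_norm_le (hKi j hj) ?_) (norm_nonneg _)
      filter_upwards [ae_pos_powMeasure (r j)] with t ht
      rw [norm_mul, Complex.norm_real, Complex.norm_real, Real.norm_of_nonneg (hK0 _),
        Real.norm_of_nonneg (Real.exp_pos _).le]
      exact mul_le_of_le_one_right (hK0 _) (Real.exp_le_one_iff.2 (by nlinarith))
    linarith [le_abs_self (∫ t : ℝ, K (t - x) * Real.exp (-(ε * t)) ∂ν),
      Real.norm_eq_abs (∫ t : ℝ, K (t - x) * Real.exp (-(ε * t)) ∂ν)]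
  refine ⟨by fun_prop, ?_⟩
  rw [hasFiniteIntegral_iff_ofReal (ae_of_all _ fun t => hK0 _)]
  let u : ℕ → ℝ := fun n => δ / (n + 2)
  have hu0 : ∀ n, 0 < u n := fun n => by positivity
  have huδ : ∀ n, u n < δ := fun n => by
    rw [div_lt_iff₀ (by positivity)]
    nlinarith [(Nat.cast_nonneg n : (0 : ℝ) ≤ n)]
  have hulim : Tendsto u atTop (𝓝 0) := by
    have h1 : Tendsto (fun n : ℕ => (n : ℝ) + 2) atTop atTop :=
      tendsto_atTop_add_const_right _ _ tendsto_natCast_atTop_atTop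
    exact h1.const_div_atTop δ
  have hlim : ∀ t : ℝ, liminf (fun n => ENNReal.ofReal (K (t - x) * Real.exp (-(u n * t)))) atTop =
      ENNReal.ofReal (K (t - x)) := by
    intro t
    refine Tendsto.liminf_eq (ENNReal.tendsto_ofReal ?_)
    have hc : Continuous fun e : ℝ => K (t - x) * Real.exp (-(e * t)) := by fun_prop
    have := (hc.tendsto 0).comp hulim
    simpa [Function.comp_def] using this
  calc ∫⁻ t, ENNReal.ofReal (K (t - x)) ∂ν
      = ∫⁻ t, liminf (fun n => ENNReal.ofReal (K (t - x) * Real.exp (-(u n * t)))) atTop ∂ν := by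
        simp_rw [hlim]
    _ ≤ liminf (fun n => ∫⁻ t, ENNReal.ofReal (K (t - x) * Real.exp (-(u n * t))) ∂ν) atTop :=
        lintegral_liminf_le fun n => by fun_prop
    _ ≤ liminf (fun _ : ℕ => ENNReal.ofReal D) atTop := by
        refine liminf_le_liminf (Eventually.of_forall fun n => ?_)
        rw [← ofReal_integral_eq_lintegral_ofReal (hdint _ (hu0 n))
          (ae_of_all _ fun t => mul_nonneg (hK0 _) (Real.exp_pos _).le)]
        exact ENNReal.ofReal_le_ofReal (hbound _ (hu0 n) (huδ n))
    _ < ⊤ := by simp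

/-- Undamped comparison, for the kernel `K` and all its modulations `K u * exp (i ξ u)`. -/
lemma exists_comparison {ν : Measure ℝ} [SFinite ν] (hν0 : ∀ᵐ t ∂ν, 0 ≤ t)
    (hν : ∀ ε : ℝ, 0 < ε → Integrable (fun t : ℝ => Real.exp (-(ε * t))) ν)
    {s : Finset ℕ} {r : ℕ → ℝ} (hr : ∀ j ∈ s, 0 < r j) {b : ℕ → ℂ} {R : ℂ → ℂ}
    (hL : ∀ z : ℂ, 0 < z.re → ∫ t : ℝ, Complex.exp (-(z * t)) ∂ν =
      ∑ j ∈ s, b j * ∫ t : ℝ, Complex.exp (-(z * t)) ∂(powMeasure (r j)) + R z)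
    {β : ℝ} (hβ0 : 0 ≤ β) (hβ : β < 1) (hR : ∀ y : ℝ, MildAt β R y)
    (hRd : ∀ z : ℂ, 0 < z.re → ContDiffAt ℂ 1 R z)
    {k : ℝ → ℂ} {K : ℝ → ℝ} (hk : ContDiff ℝ 1 k) (hks : HasCompactSupport k)
    (hKc : Continuous K) (hK0 : ∀ u, 0 ≤ K u) {p : ℕ} {C : ℝ} (hrp : ∀ j ∈ s, r j < p)
    (hKC : ∀ u, K u ≤ C / (1 + |u|) ^ p)
    (hK : ∀ u : ℝ, (K u : ℂ) = ∫ y, k y * Complex.exp (Complex.I * u * y)) :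
    (∀ x : ℝ, 0 < x → Integrable (fun t => K (t - x)) ν) ∧
    ∀ ξ : ℝ, ∃ B : ℝ, ∀ x : ℝ, 0 < x →
      ‖∫ t : ℝ, (K (t - x) : ℂ) * Complex.exp (ξ * (t - x : ℝ) * Complex.I) ∂ν -
        ∑ j ∈ s, b j * ∫ t : ℝ, (K (t - x) : ℂ) * Complex.exp (ξ * (t - x : ℝ) * Complex.I)
          ∂(powMeasure (r j))‖ ≤ B / x := by
  have hC : 0 ≤ C := by
    have := (hK0 0).trans (hKC 0)
    simpa using this
  have hKM : ∀ u, K u ≤ C := fun u =>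
    (hKC u).trans (div_le_self hC (one_le_pow₀ (by linarith [abs_nonneg u])))
  have hKi : ∀ x : ℝ, 0 < x → ∀ j ∈ s, Integrable (fun t => K (t - x)) (powMeasure (r j)) := by
    intro x hx j hj
    refine ((integrable_one_add_abs_powMeasure (hr j hj) (hrp j hj) hx.le).const_mul C).mono'
      (by fun_prop) (ae_of_all _ fun t => ?_)
    rw [Real.norm_of_nonneg (hK0 _), mul_one_div]
    exact hKC _
  have hKν : ∀ x : ℝ, 0 < x → Integrable (fun t => K (t - x)) ν := by
    intro x hx
    obtain ⟨δ, hδ, B, hB⟩ := exists_damped_comparison hν hr hL hβ0 hβ hR hRd hk hks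
      (K := fun u => (K u : ℂ)) hK
    exact integrable_kernel_of_damped_comparison hν hKc hK0 hKM (hKi x hx) hδ
      fun ε hε hεδ => hB ε x hε hεδ hx
  refine ⟨hKν, fun ξ => ?_⟩
  obtain ⟨δ, hδ, B, hB⟩ := exists_damped_comparison hν hr hL hβ0 hβ hR hRd
    (k := fun y => k (y - ξ)) (K := fun u => (K u : ℂ) * Complex.exp (ξ * u * Complex.I))
    (hk.comp (contDiff_id.sub contDiff_const))
    (hks.comp_homeomorph (Homeomorph.subRight ξ)) (fun u => by
      rw [hK u, ← integral_mul_const,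
        ← integral_sub_right_eq_self (fun y => k y * Complex.exp (Complex.I * u * y) *
          Complex.exp (ξ * u * Complex.I)) ξ]
      refine integral_congr_ae (ae_of_all _ fun y => ?_)
      simp only
      rw [mul_assoc, ← Complex.exp_add]
      congr 2
      push_cast
      ring)
  refine ⟨B, fun x hx => ?_⟩
  have hmod : ∀ μ : Measure ℝ, Integrable (fun t => K (t - x)) μ → Integrable (fun t : ℝ =>
      (K (t - x) : ℂ) * Complex.exp (ξ * (t - x : ℝ) * Complex.I)) μ := fun μ hμ =>
    hμ.ofReal.mul_bdd (c := 1) (by fun_prop) (ae_of_all _ fun t => by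
      rw [← Complex.ofReal_mul, Complex.norm_exp_ofReal_mul_I])
  have hlim := (tendsto_integral_mul_exp hν0 (hmod ν (hKν x hx))).sub
    (tendsto_finsetSum s fun j hj => (tendsto_integral_mul_exp
      ((ae_pos_powMeasure (r j)).mono fun t ht => ht.le)
      (hmod _ (hKi x hx j hj))).const_mul (b j))
  refine le_of_tendsto hlim.norm ?_
  filter_upwards [Ioo_mem_nhdsGT hδ] with ε hε
  exact hB ε x hε.1 hε.2 hx

/-! ### Smoothed asymptotics of the model measures -/

lemma rpow_sub_one_le {r v w : ℝ} (hr : 0 < r) (hv : 1 / 2 ≤ v) (hvw : v ≤ w) (hw : 1 ≤ w) :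
    v ^ (r - 1) ≤ 2 * w ^ r := by
  have hv0 : 0 < v := by linarith
  have h1 : v ^ r ≤ w ^ r := Real.rpow_le_rpow hv0.le hvw hr.le
  rw [Real.rpow_sub_one hv0.ne', div_le_iff₀ hv0]
  have : 0 ≤ w ^ r := by positivity
  nlinarith

/-- The part of the model integral far from the peak of the kernel is negligible. -/
lemma tendsto_model_far {r : ℝ} (hr : 0 < r) {p : ℕ} (hp : 2 ≤ p) {C : ℝ} {K : ℝ → ℂ}
    (hKC : ∀ u, ‖K u‖ ≤ C / (1 + |u|) ^ p) :
    Tendsto (fun x : ℝ => (x ^ (1 - r) : ℝ) *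
      ∫ t in Set.Ioc (0 : ℝ) (x / 2), ((t ^ (r - 1) : ℝ) : ℂ) * K (t - x)) atTop (𝓝 0) := by
  have hC : 0 ≤ C := by
    have := (norm_nonneg _).trans (hKC 0)
    simpa using this
  have hlim : Tendsto (fun x : ℝ => 4 * C / r / x) atTop (𝓝 0) :=
    tendsto_id.const_div_atTop _
  refine squeeze_zero_norm' ?_ hlim
  filter_upwards [eventually_ge_atTop 1] with x hx
  have hx0 : 0 < x := by linarith
  have hint : IntegrableOn (fun t : ℝ => t ^ (r - 1)) (Set.Ioc 0 (x / 2)) := by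
    rw [← intervalIntegrable_iff_integrableOn_Ioc_of_le (by linarith)]
    exact intervalIntegral.intervalIntegrable_rpow' (by linarith)
  have h1 : ‖∫ t in Set.Ioc (0 : ℝ) (x / 2), ((t ^ (r - 1) : ℝ) : ℂ) * K (t - x)‖ ≤
      ∫ t in Set.Ioc (0 : ℝ) (x / 2), t ^ (r - 1) * (C / (x / 2) ^ 2) := by
    refine norm_integral_le_of_norm_le (hint.mul_const _) ?_
    filter_upwards [ae_restrict_mem measurableSet_Ioc] with t ht
    have h0 : 0 ≤ t ^ (r - 1) := Real.rpow_nonneg ht.1.le _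
    rw [norm_mul, Complex.norm_real, Real.norm_of_nonneg h0]
    refine mul_le_mul_of_nonneg_left ((hKC _).trans ?_) h0
    have hab : x / 2 ≤ |t - x| := by
      rw [abs_sub_comm]
      exact le_trans (by linarith [ht.2]) (le_abs_self _)
    refine div_le_div_of_nonneg_left hC (by positivity) ?_
    calc (x / 2) ^ 2 ≤ (1 + |t - x|) ^ 2 := by
          gcongr
          linarith
      _ ≤ (1 + |t - x|) ^ p := pow_le_pow_right₀ (by linarith [abs_nonneg (t - x)]) hp
  have h2 : ∫ t in Set.Ioc (0 : ℝ) (x / 2), t ^ (r - 1) = (x / 2) ^ r / r := by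
    rw [← intervalIntegral.integral_of_le (by linarith), integral_rpow (Or.inl (by linarith)),
      sub_add_cancel, Real.zero_rpow hr.ne', sub_zero]
  rw [integral_mul_const, h2] at h1
  rw [norm_mul, Complex.norm_real, Real.norm_of_nonneg (Real.rpow_nonneg hx0.le _)]
  calc x ^ (1 - r) * ‖∫ t in Set.Ioc (0 : ℝ) (x / 2), ((t ^ (r - 1) : ℝ) : ℂ) * K (t - x)‖
      ≤ x ^ (1 - r) * ((x / 2) ^ r / r * (C / (x / 2) ^ 2)) := by gcongr
    _ ≤ x ^ (1 - r) * (x ^ r / r * (C / (x / 2) ^ 2)) := by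
        gcongr
        linarith
    _ = 4 * C / r / x := by
        rw [Real.rpow_sub hx0, Real.rpow_one]
        have : x ^ r ≠ 0 := (Real.rpow_pos_of_pos hx0 r).ne'
        field_simp
        ring

/-- The part of the model integral around the peak of the kernel carries the full mass. -/
lemma tendsto_model_near {r : ℝ} (hr : 0 < r) {p : ℕ} (hp : r + 1 < p) {C : ℝ} {K : ℝ → ℂ}
    (hKc : Continuous K) (hKC : ∀ u, ‖K u‖ ≤ C / (1 + |u|) ^ p) :
    Tendsto (fun x : ℝ => (x ^ (1 - r) : ℝ) *
      ∫ t in Set.Ioi (x / 2), ((t ^ (r - 1) : ℝ) : ℂ) * K (t - x)) atTop (𝓝 (∫ u, K u)) := by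
  have hC : 0 ≤ C := by
    have := (norm_nonneg _).trans (hKC 0)
    simpa using this
  have hform : ∀ᶠ x : ℝ in atTop, ∫ u, (Set.Ioi (-(x / 2))).indicator
        (fun u => (((1 + u / x) ^ (r - 1) : ℝ) : ℂ) * K u) u =
      (x ^ (1 - r) : ℝ) * ∫ t in Set.Ioi (x / 2), ((t ^ (r - 1) : ℝ) : ℂ) * K (t - x) := by
    filter_upwards [eventually_gt_atTop 0] with x hx
    rw [← integral_const_mul, ← integral_indicator measurableSet_Ioi,
      ← integral_sub_right_eq_self _ x]
    refine integral_congr_ae (ae_of_all _ fun t => ?_)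
    simp only
    by_cases ht : t ∈ Set.Ioi (x / 2)
    · have ht' : t - x ∈ Set.Ioi (-(x / 2)) := by
        simp only [Set.mem_Ioi] at ht ⊢
        linarith
      have ht0 : 0 < t := lt_trans (by linarith) ht
      rw [Set.indicator_of_mem ht, Set.indicator_of_mem ht',
        show 1 + (t - x) / x = t / x by field_simp; ring, Real.div_rpow ht0.le hx.le,
        ← mul_assoc, ← Complex.ofReal_mul]
      congr 2
      rw [show 1 - r = -(r - 1) by ring, Real.rpow_neg hx.le]
      field_simp
    · have ht' : t - x ∉ Set.Ioi (-(x / 2)) := by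
        simp only [Set.mem_Ioi] at ht ⊢
        linarith
      rw [Set.indicator_of_notMem ht, Set.indicator_of_notMem ht']
  refine Tendsto.congr' hform ?_
  refine tendsto_integral_filter_of_dominated_convergence
    (fun u => 2 * C * (1 + ‖u‖) ^ (-((p : ℝ) - r))) ?_ ?_ ?_ (ae_of_all _ fun u => ?_)
  · refine Eventually.of_forall fun x => ?_
    refine (Measurable.indicator ?_ measurableSet_Ioi).aestronglyMeasurable
    exact (Complex.measurable_ofReal.comp
      ((by fun_prop : Measurable fun u : ℝ => 1 + u / x).pow_const (r - 1))).mul hKc.measurable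
  · filter_upwards [eventually_ge_atTop 1] with x hx
    refine ae_of_all _ fun u => ?_
    have hx0 : 0 < x := by linarith
    have hpos : (0 : ℝ) < 1 + |u| := by positivity
    by_cases hu : u ∈ Set.Ioi (-(x / 2))
    · rw [Set.indicator_of_mem hu]
      have hu' : -(x / 2) < u := hu
      have h1 : 1 / 2 ≤ 1 + u / x := by
        have : -(1 / 2) ≤ u / x := by
          rw [le_div_iff₀ hx0]
          linarith
        linarith
      have h2 : 1 + u / x ≤ 1 + |u| := by
        have : u / x ≤ |u| := by
          rw [div_le_iff₀ hx0]
          nlinarith [le_abs_self u, abs_nonneg u]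
        linarith
      rw [norm_mul, Complex.norm_real,
        Real.norm_of_nonneg (Real.rpow_nonneg (by linarith : 0 ≤ 1 + u / x) _)]
      calc (1 + u / x) ^ (r - 1) * ‖K u‖
          ≤ (2 * (1 + |u|) ^ r) * (C / (1 + |u|) ^ p) :=
            mul_le_mul (rpow_sub_one_le hr h1 h2 (by linarith [abs_nonneg u])) (hKC u)
              (norm_nonneg _) (by positivity)
        _ = _ := by
            rw [Real.norm_eq_abs, neg_sub, Real.rpow_sub hpos, Real.rpow_natCast]
            ring
    · rw [Set.indicator_of_notMem hu, norm_zero]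
      positivity
  · exact (integrable_one_add_norm (by simp; linarith)).const_mul _
  · have h1 : Tendsto (fun x : ℝ => 1 + u / x) atTop (𝓝 1) := by
      simpa using (tendsto_id.const_div_atTop u).const_add 1
    have h2 : Tendsto (fun x : ℝ => (1 + u / x) ^ (r - 1)) atTop (𝓝 1) := by
      simpa using h1.rpow_const (p := r - 1) (Or.inl one_ne_zero)
    have h3 : Tendsto (fun x : ℝ => (((1 + u / x) ^ (r - 1) : ℝ) : ℂ) * K u) atTop (𝓝 (K u)) := by
      simpa using ((Complex.continuous_ofReal.tendsto 1).comp h2).mul_const (K u)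
    refine h3.congr' ?_
    filter_upwards [eventually_gt_atTop (2 * |u|)] with x hx
    rw [Set.indicator_of_mem]
    simp only [Set.mem_Ioi]
    linarith [neg_abs_le u]

/-- Smoothing the model measure by a rapidly decaying kernel reproduces its density. -/
lemma tendsto_integral_powMeasure {r : ℝ} (hr : 0 < r) {p : ℕ} (hp : r + 1 < p) {C : ℝ}
    {K : ℝ → ℂ} (hKc : Continuous K) (hKC : ∀ u, ‖K u‖ ≤ C / (1 + |u|) ^ p) :
    Tendsto (fun x : ℝ => (x ^ (1 - r) : ℝ) * ∫ t, K (t - x) ∂(powMeasure r)) atTop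
      (𝓝 (∫ u, K u)) := by
  have hp2 : 2 ≤ p := by
    have : (1 : ℝ) < p := by linarith
    exact_mod_cast this
  have h := (tendsto_model_far hr hp2 hKC).add (tendsto_model_near hr hp hKc hKC)
  rw [zero_add] at h
  refine h.congr' ?_
  filter_upwards [eventually_gt_atTop 0] with x hx
  have hint : IntegrableOn (fun t : ℝ => ((t ^ (r - 1) : ℝ) : ℂ) * K (t - x)) (Set.Ioi 0) := by
    have h1 : Integrable (fun t => K (t - x)) (powMeasure r) := by
      refine ((integrable_one_add_abs_powMeasure hr (by linarith) hx.le).const_mul C).mono'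
        (by fun_prop) (ae_of_all _ fun t => ?_)
      rw [mul_one_div]
      exact hKC _
    simpa [Complex.real_smul] using (integrable_powMeasure_iff r _).1 h1
  rw [integral_powMeasure, ← mul_add, ← setIntegral_union (Set.Ioc_disjoint_Ioi le_rfl)
    measurableSet_Ioi (hint.mono_set Set.Ioc_subset_Ioi_self)
    (hint.mono_set (Set.Ioi_subset_Ioi (by linarith))), Set.Ioc_union_Ioi_eq_Ioi (by linarith)]

/-! ### Weak convergence of the rescaled translates -/

/-- Lévy's continuity theorem for finite measures. -/
lemma tendsto_finiteMeasure_of_tendsto_charFun {μ : ℕ → FiniteMeasure ℝ} {μ₀ : FiniteMeasure ℝ}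
    (h0 : μ₀ ≠ 0)
    (h : ∀ ξ : ℝ, Tendsto (fun n => charFun (μ n : Measure ℝ) ξ) atTop
      (𝓝 (charFun (μ₀ : Measure ℝ) ξ))) :
    Tendsto μ atTop (𝓝 μ₀) := by
  have hmassC : ∀ m : FiniteMeasure ℝ, charFun (m : Measure ℝ) 0 = ((m.mass : ℝ) : ℂ) := by
    intro m
    rw [charFun_zero]
    rfl
  have hmassR : Tendsto (fun n => ((μ n).mass : ℝ)) atTop (𝓝 (μ₀.mass : ℝ)) := by
    have := h 0
    simp_rw [hmassC] at this
    exact (Complex.continuous_re.tendsto _).comp this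
  have hmass : Tendsto (fun n => (μ n).mass) atTop (𝓝 μ₀.mass) := NNReal.tendsto_coe.1 hmassR
  have hm0 : μ₀.mass ≠ 0 := μ₀.mass_nonzero_iff.2 h0
  have hchar : ∀ m : FiniteMeasure ℝ, m ≠ 0 → ∀ ξ : ℝ,
      charFun (m.normalize : Measure ℝ) ξ = ((m.mass : ℝ) : ℂ)⁻¹ * charFun (m : Measure ℝ) ξ := by
    intro m hm ξ
    rw [m.toMeasure_normalize_eq_of_nonzero hm, charFun_apply_real, charFun_apply_real,
      integral_smul_nnreal_measure, NNReal.smul_def, Complex.real_smul]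
    push_cast
    rfl
  have hne : ∀ᶠ n in atTop, μ n ≠ 0 := by
    filter_upwards [hmass.eventually_ne hm0] with n hn
    exact (μ n).mass_nonzero_iff.1 hn
  refine FiniteMeasure.tendsto_of_tendsto_normalize_testAgainstNN_of_tendsto_mass ?_ hmass
  refine ProbabilityMeasure.tendsto_iff_tendsto_charFun.2 fun ξ => ?_
  rw [hchar μ₀ h0]
  have hm0' : ((μ₀.mass : ℝ) : ℂ) ≠ 0 := by exact_mod_cast hm0
  refine Tendsto.congr' ?_ ((((Complex.continuous_ofReal.tendsto _).comp hmassR).inv₀ hm0').mul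
    (h ξ))
  filter_upwards [hne] with n hn
  rw [hchar _ hn]
  rfl

/-- The measure `w · K(t - x) dν(t)`, moved to the origin. -/
noncomputable def translatedMeasure (ν : Measure ℝ) (K : ℝ → ℝ) (w x : ℝ) : Measure ℝ :=
  (ν.withDensity fun t => ENNReal.ofReal (w * K (t - x))).map fun t => t - x

lemma integral_translatedMeasure {ν : Measure ℝ} {K : ℝ → ℝ} (hK : Continuous K)
    (hK0 : ∀ u, 0 ≤ K u) {w : ℝ} (hw : 0 ≤ w) (x : ℝ) {E : Type*} [NormedAddCommGroup E]
    [NormedSpace ℝ E] {f : ℝ → E} (hf : Continuous f) [SecondCountableTopology E] :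
    ∫ u, f u ∂(translatedMeasure ν K w x) = w • ∫ t, K (t - x) • f (t - x) ∂ν := by
  rw [translatedMeasure, integral_map (by fun_prop) hf.aestronglyMeasurable,
    integral_withDensity_eq_integral_toReal_smul (by fun_prop)
      (ae_of_all _ fun _ => ENNReal.ofReal_lt_top), ← integral_smul]
  refine integral_congr_ae (ae_of_all _ fun t => ?_)
  simp only
  rw [ENNReal.toReal_ofReal (mul_nonneg hw (hK0 _)), mul_smul]

lemma isFiniteMeasure_translatedMeasure {ν : Measure ℝ} {K : ℝ → ℝ} {x : ℝ}
    (hK : Integrable (fun t => K (t - x)) ν) (w : ℝ) :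
    IsFiniteMeasure (translatedMeasure ν K w x) := by
  have := isFiniteMeasure_withDensity_ofReal (hK.const_mul w).2
  unfold translatedMeasure
  infer_instance

/-- If the translates of `ν`, rescaled by `w`, pair asymptotically with all modulations of a
positive kernel `K` like a multiple `A` of Lebesgue measure, then they do so with every
continuous function dominated by `K`. -/
lemma tendsto_integral_of_tendsto_modulated {ν : Measure ℝ} {K : ℝ → ℝ} {w : ℝ → ℝ}
    (hw : ∀ x : ℝ, 0 < x → 0 ≤ w x) (hKc : Continuous K) (hK0 : ∀ u, 0 < K u)
    (hKi : Integrable K) {A : ℝ} (hA : 0 < A)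
    (hKν : ∀ x : ℝ, 0 < x → Integrable (fun t => K (t - x)) ν)
    (h : ∀ ξ : ℝ, Tendsto (fun x : ℝ => (w x : ℂ) *
      ∫ t : ℝ, (K (t - x) : ℂ) * Complex.exp (ξ * (t - x : ℝ) * Complex.I) ∂ν) atTop
      (𝓝 (A * ∫ u : ℝ, (K u : ℂ) * Complex.exp (ξ * u * Complex.I))))
    {ψ : ℝ → ℝ} (hψ : Continuous ψ) {M : ℝ} (hM : ∀ u, |ψ u| ≤ M * K u) :
    Tendsto (fun x : ℝ => w x * ∫ t, ψ (t - x) ∂ν) atTop (𝓝 (A * ∫ u, ψ u)) := by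
  have hpos : ∀ y : ℝ, 0 < max y 1 := fun y => lt_max_of_lt_right one_pos
  have hKi' : Integrable (fun t => K (t - 0)) := by simpa using hKi
  -- Lévy's theorem is about sequences; `max (y n) 1` keeps every term in the range where the
  -- measures are finite.
  refine tendsto_of_seq_tendsto fun y hy => ?_
  let μ : ℕ → FiniteMeasure ℝ := fun n =>
    ⟨translatedMeasure ν K (w (max (y n) 1)) (max (y n) 1),
      isFiniteMeasure_translatedMeasure (hKν _ (hpos (y n))) _⟩
  let μ₀ : FiniteMeasure ℝ := ⟨translatedMeasure volume K A 0,
    isFiniteMeasure_translatedMeasure hKi' _⟩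
  have hcoe : ∀ n, (μ n : Measure ℝ) =
      translatedMeasure ν K (w (max (y n) 1)) (max (y n) 1) := fun n => rfl
  have hcoe₀ : (μ₀ : Measure ℝ) = translatedMeasure volume K A 0 := rfl
  have hμ : ∀ (n : ℕ) (f : ℝ → ℝ), Continuous f → ∫ u, f u ∂(μ n : Measure ℝ) =
      w (max (y n) 1) * ∫ t, K (t - max (y n) 1) * f (t - max (y n) 1) ∂ν := fun n f hf => by
    exact integral_translatedMeasure hKc (fun u => (hK0 u).le) (hw _ (hpos (y n))) _ hf
  have hμ₀ : ∀ f : ℝ → ℝ, Continuous f → ∫ u, f u ∂(μ₀ : Measure ℝ) = A * ∫ u, K u * f u :=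
    fun f hf => by
    have := integral_translatedMeasure (ν := volume) hKc (fun u => (hK0 u).le) hA.le 0 hf
    rw [hcoe₀]
    simpa using this
  have hmax : ∀ᶠ n in atTop, max (y n) 1 = y n := by
    filter_upwards [hy.eventually_ge_atTop 1] with n hn
    exact max_eq_left hn
  have hmass : 0 < ∫ u, K u := by
    rw [integral_pos_iff_support_of_nonneg (fun u => (hK0 u).le) hKi]
    rw [show Function.support K = Set.univ from Set.eq_univ_of_forall fun u => (hK0 u).ne']
    simp
  have hne : μ₀ ≠ 0 := by
    intro h0
    have h1 := hμ₀ (fun _ => 1) continuous_const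
    rw [h0] at h1
    simp only [FiniteMeasure.toMeasure_zero, integral_zero_measure, mul_one] at h1
    exact (mul_pos hA hmass).ne h1
  have hconv : Tendsto μ atTop (𝓝 μ₀) := by
    refine tendsto_finiteMeasure_of_tendsto_charFun hne fun ξ => ?_
    have hcont : Continuous fun u : ℝ => Complex.exp (ξ * u * Complex.I) := by fun_prop
    have e0 : charFun (μ₀ : Measure ℝ) ξ =
        A * ∫ u : ℝ, (K u : ℂ) * Complex.exp (ξ * u * Complex.I) := by
      rw [charFun_apply_real, hcoe₀]
      have := integral_translatedMeasure (ν := volume) hKc (fun u => (hK0 u).le) hA.le 0 hcont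
      simpa using this
    have e1 : ∀ n, charFun (μ n : Measure ℝ) ξ = (w (max (y n) 1) : ℂ) *
        ∫ t : ℝ, (K (t - max (y n) 1) : ℂ) *
          Complex.exp (ξ * (t - max (y n) 1 : ℝ) * Complex.I) ∂ν := by
      intro n
      rw [charFun_apply_real, hcoe]
      have := integral_translatedMeasure (ν := ν) hKc (fun u => (hK0 u).le)
        (hw _ (hpos (y n))) (max (y n) 1) hcont
      simpa only [Complex.real_smul] using this
    rw [e0]
    refine ((h ξ).comp hy).congr' ?_
    filter_upwards [hmax] with n hn
    rw [e1 n, hn]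
    rfl
  let f : BoundedContinuousFunction ℝ ℝ := BoundedContinuousFunction.ofNormedAddCommGroup
    (fun u => ψ u / K u) (hψ.div hKc fun u => (hK0 u).ne') M (fun u => by
      rw [Real.norm_eq_abs, abs_div, abs_of_pos (hK0 u), div_le_iff₀ (hK0 u)]
      exact hM u)
  have hf : ∀ u, K u * f u = ψ u := fun u => mul_div_cancel₀ _ (hK0 u).ne'
  have hlim := (FiniteMeasure.tendsto_iff_forall_integral_tendsto.1 hconv) f
  rw [hμ₀ f f.continuous] at hlim
  simp_rw [hμ _ f f.continuous, hf] at hlim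
  refine hlim.congr' ?_
  filter_upwards [hmax] with n hn
  rw [hn]
  rfl

lemma exp_mul_le_of_le_one {d : ℝ} (hd : 0 < d) (p : ℕ) {u : ℝ} (hu : u ≤ 1) :
    Real.exp (d * u) ≤ (p.factorial / d ^ p * Real.exp (3 * d)) * (1 / (1 + |u|) ^ p) := by
  have hpos : 0 < 1 + |u| := by positivity
  rw [mul_one_div, le_div_iff₀ (pow_pos hpos p)]
  have h1 := Real.pow_div_factorial_le_exp (x := d * (1 + |u|)) (by positivity) p
  rw [div_le_iff₀ (by positivity), mul_pow] at h1
  have h2 : (1 + |u|) ^ p ≤ p.factorial / d ^ p * Real.exp (d * (1 + |u|)) := by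
    rw [div_mul_eq_mul_div, le_div_iff₀ (by positivity)]
    linarith
  have h3 : u + |u| ≤ 2 := by
    rcases abs_cases u with h | h <;> linarith
  calc Real.exp (d * u) * (1 + |u|) ^ p
      ≤ Real.exp (d * u) * (p.factorial / d ^ p * Real.exp (d * (1 + |u|))) := by gcongr
    _ = p.factorial / d ^ p * Real.exp (d * u + d * (1 + |u|)) := by
        rw [Real.exp_add]
        ring
    _ ≤ _ := by
        gcongr
        nlinarith

/-- The passage from continuous test functions to the one-sided exponential, by squeezing the jump
at the origin between continuous ramps. -/
lemma tendsto_integral_exp_Iic {ν : Measure ℝ} {w : ℝ → ℝ} (hw : ∀ x : ℝ, 0 < x → 0 ≤ w x)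
    {A d : ℝ} (hA : 0 < A) (hd : 0 < d) {p : ℕ}
    (hν : ∀ x : ℝ, 0 < x → Integrable (fun t => 1 / (1 + |t - x|) ^ p) ν)
    (h : ∀ ψ : ℝ → ℝ, Continuous ψ → (∃ M, ∀ u, |ψ u| ≤ M * (1 / (1 + |u|) ^ p)) →
      Tendsto (fun x : ℝ => w x * ∫ t, ψ (t - x) ∂ν) atTop (𝓝 (A * ∫ u, ψ u))) :
    Tendsto (fun x : ℝ => w x * ∫ t in Set.Iic x, Real.exp (d * (t - x)) ∂ν) atTop
      (𝓝 (A / d)) := by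
  -- `ramp δ` is continuous, equal to `1` on `u ≤ 0` and to `0` on `u ≥ δ`.
  let ramp : ℝ → ℝ → ℝ := fun δ u => max 0 (min 1 (1 - u / δ))
  have ramp0 : ∀ δ u, 0 ≤ ramp δ u := fun δ u => le_max_left _ _
  have ramp1 : ∀ δ u, ramp δ u ≤ 1 := fun δ u => max_le zero_le_one (min_le_left _ _)
  have ramp_left : ∀ δ u, 0 < δ → u ≤ 0 → ramp δ u = 1 := by
    intro δ u hδ hu
    have : u / δ ≤ 0 := div_nonpos_of_nonpos_of_nonneg hu hδ.le
    simp only [ramp]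
    rw [min_eq_left (by linarith), max_eq_right zero_le_one]
  have ramp_right : ∀ δ u, 0 < δ → δ ≤ u → ramp δ u = 0 := by
    intro δ u hδ hu
    have : 1 ≤ u / δ := by rwa [le_div_iff₀ hδ, one_mul]
    simp only [ramp]
    rw [max_eq_left]
    exact (min_le_right _ _).trans (by linarith)
  have ramp_cont : ∀ δ, Continuous (ramp δ) := fun δ => by
    simp only [ramp]
    fun_prop
  -- The two test functions are `exp (d u) * ramp δ (u + a)` for `a = 0` and `a = δ`.
  have hbd : ∀ δ a : ℝ, 0 < δ → δ ≤ 1 → 0 ≤ a → ∀ u : ℝ, |Real.exp (d * u) * ramp δ (u + a)| ≤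
      (p.factorial / d ^ p * Real.exp (3 * d)) * (1 / (1 + |u|) ^ p) := by
    intro δ a hδ hδ1 ha u
    rw [abs_of_nonneg (mul_nonneg (Real.exp_pos _).le (ramp0 _ _))]
    by_cases hu : u ≤ 1
    · exact (mul_le_of_le_one_right (Real.exp_pos _).le (ramp1 _ _)).trans
        (exp_mul_le_of_le_one hd p hu)
    · rw [ramp_right δ _ hδ (by linarith), mul_zero]
      positivity
  have hcont : ∀ δ a : ℝ, Continuous fun u : ℝ => Real.exp (d * u) * ramp δ (u + a) := fun δ a =>
    (by fun_prop : Continuous fun u : ℝ => Real.exp (d * u)).mul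
      ((ramp_cont δ).comp (continuous_add_const a))
  have hint : ∀ δ a x : ℝ, 0 < δ → δ ≤ 1 → 0 ≤ a → 0 < x →
      Integrable (fun t => Real.exp (d * (t - x)) * ramp δ (t - x + a)) ν := by
    intro δ a x hδ hδ1 ha hx
    refine ((hν x hx).const_mul (p.factorial / d ^ p * Real.exp (3 * d))).mono'
      ((hcont δ a).comp (continuous_sub_right x)).aestronglyMeasurable (ae_of_all _ fun t => ?_)
    exact hbd δ a hδ hδ1 ha (t - x)
  have hφint : ∀ x : ℝ, 0 < x → Integrable ((Set.Iic x).indicator fun t =>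
      Real.exp (d * (t - x))) ν := by
    intro x hx
    refine (hint 1 0 x one_pos le_rfl le_rfl hx).mono'
      ((by fun_prop : Measurable fun t => Real.exp (d * (t - x))).indicator
        measurableSet_Iic).aestronglyMeasurable (ae_of_all _ fun t => ?_)
    by_cases ht : t ∈ Set.Iic x
    · have ht' : t ≤ x := ht
      rw [Set.indicator_of_mem ht, ramp_left 1 _ one_pos (by linarith), mul_one,
        Real.norm_of_nonneg (Real.exp_pos _).le]
    · rw [Set.indicator_of_notMem ht, norm_zero]
      exact mul_nonneg (Real.exp_pos _).le (ramp0 _ _)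
  have hvint : ∀ δ a : ℝ, 0 < δ → δ ≤ 1 → 0 ≤ a →
      Integrable fun u : ℝ => Real.exp (d * u) * ramp δ (u + a) := by
    intro δ a hδ hδ1 ha
    have h1 : Integrable ((Set.Iic (1 : ℝ)).indicator fun u => Real.exp (d * u)) :=
      (integrable_indicator_iff measurableSet_Iic).2 (integrableOn_exp_mul_Iic hd 1)
    refine h1.mono' (hcont δ a).aestronglyMeasurable (ae_of_all _ fun u => ?_)
    rw [Real.norm_of_nonneg (mul_nonneg (Real.exp_pos _).le (ramp0 _ _))]
    by_cases hu : u ∈ Set.Iic (1 : ℝ)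
    · rw [Set.indicator_of_mem hu]
      exact mul_le_of_le_one_right (Real.exp_pos _).le (ramp1 _ _)
    · rw [Set.indicator_of_notMem hu, ramp_right δ _ hδ (by
        simp only [Set.mem_Iic, not_le] at hu
        linarith), mul_zero]
  have hexp : ∀ a : ℝ, ∫ u, (Set.Iic a).indicator (fun u => Real.exp (d * u)) u =
      Real.exp (d * a) / d := fun a => by
    rw [integral_indicator measurableSet_Iic, integral_exp_mul_Iic hd]
  have hexpint : ∀ a : ℝ, Integrable ((Set.Iic a).indicator fun u => Real.exp (d * u)) :=
    fun a => (integrable_indicator_iff measurableSet_Iic).2 (integrableOn_exp_mul_Iic hd a)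
  have hδlim : ∀ e : ℝ, Tendsto (fun δ : ℝ => A * (Real.exp (d * (e * δ)) / d)) (𝓝[>] 0)
      (𝓝 (A / d)) := by
    intro e
    have hc : Continuous fun δ : ℝ => A * (Real.exp (d * (e * δ)) / d) := by fun_prop
    have := (hc.tendsto 0).mono_left (nhdsWithin_le_nhds (s := Set.Ioi 0))
    simpa [div_eq_mul_inv] using this
  refine tendsto_order.2 ⟨fun a' ha' => ?_, fun a' ha' => ?_⟩
  · obtain ⟨δ, hδa, hδ, hδ1⟩ := (((hδlim (-1)).eventually_const_lt ha').and
      (Ioo_mem_nhdsGT one_pos)).exists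
    have hlow : A * (Real.exp (d * (-1 * δ)) / d) ≤
        A * ∫ u : ℝ, Real.exp (d * u) * ramp δ (u + δ) := by
      rw [← hexp]
      refine mul_le_mul_of_nonneg_left (integral_mono (hexpint _)
        (hvint δ δ hδ hδ1.le hδ.le) fun u => ?_) hA.le
      by_cases hu : u ∈ Set.Iic (-1 * δ)
      · have hu' : u ≤ -1 * δ := hu
        simp only [Set.indicator_of_mem hu]
        rw [ramp_left δ _ hδ (by linarith), mul_one]
      · simp only [Set.indicator_of_notMem hu]
        exact mul_nonneg (Real.exp_pos _).le (ramp0 _ _)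
    filter_upwards [(h _ (hcont δ δ) ⟨_, hbd δ δ hδ hδ1.le hδ.le⟩).eventually_const_lt
      (hδa.trans_le hlow), eventually_gt_atTop 0] with x hx hx0
    refine hx.trans_le (mul_le_mul_of_nonneg_left ?_ (hw x hx0))
    rw [← integral_indicator measurableSet_Iic]
    refine integral_mono (hint δ δ x hδ hδ1.le hδ.le hx0) (hφint x hx0) fun t => ?_
    by_cases ht : t ∈ Set.Iic x
    · simp only [Set.indicator_of_mem ht]
      exact mul_le_of_le_one_right (Real.exp_pos _).le (ramp1 _ _)
    · have ht' : x < t := by simpa using ht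
      simp only [Set.indicator_of_notMem ht]
      rw [ramp_right δ _ hδ (by linarith), mul_zero]
  · obtain ⟨δ, hδa, hδ, hδ1⟩ := (((hδlim 1).eventually_lt_const ha').and
      (Ioo_mem_nhdsGT one_pos)).exists
    have hup : A * ∫ u : ℝ, Real.exp (d * u) * ramp δ (u + 0) ≤
        A * (Real.exp (d * (1 * δ)) / d) := by
      rw [← hexp]
      refine mul_le_mul_of_nonneg_left (integral_mono
        (hvint δ 0 hδ hδ1.le le_rfl) (hexpint _) fun u => ?_) hA.le
      by_cases hu : u ∈ Set.Iic (1 * δ)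
      · simp only [Set.indicator_of_mem hu]
        exact mul_le_of_le_one_right (Real.exp_pos _).le (ramp1 _ _)
      · have hu' : 1 * δ < u := by simpa using hu
        simp only [Set.indicator_of_notMem hu]
        rw [ramp_right δ _ hδ (by linarith), mul_zero]
    filter_upwards [(h _ (hcont δ 0) ⟨_, hbd δ 0 hδ hδ1.le le_rfl⟩).eventually_lt_const
      (hup.trans_lt hδa), eventually_gt_atTop 0] with x hx hx0
    refine lt_of_le_of_lt (mul_le_mul_of_nonneg_left ?_ (hw x hx0)) hx
    rw [← integral_indicator measurableSet_Iic]
    refine integral_mono (hφint x hx0) (hint δ 0 x hδ hδ1.le le_rfl hx0) fun t => ?_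
    by_cases ht : t ∈ Set.Iic x
    · have ht' : t ≤ x := ht
      simp only [Set.indicator_of_mem ht]
      rw [ramp_left δ _ hδ (by linarith), mul_one]
    · simp only [Set.indicator_of_notMem ht]
      exact mul_nonneg (Real.exp_pos _).le (ramp0 _ _)

/-! ### The Tauberian theorem for measures -/

/-- The Tauberian theorem for measures: only the leading term of the singular expansion of the
Laplace transform at the origin matters, provided the remainder is mild. -/
theorem tendsto_of_laplace_eq {ν : Measure ℝ} [SFinite ν] (hν0 : ∀ᵐ t ∂ν, 0 ≤ t)
    (hν : ∀ ε : ℝ, 0 < ε → Integrable (fun t : ℝ => Real.exp (-(ε * t))) ν)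
    {s : Finset ℕ} (hs : 0 ∈ s) {r : ℕ → ℝ} (hr : ∀ j ∈ s, 0 < r j)
    (hr0 : ∀ j ∈ s, j ≠ 0 → r j < r 0) {b : ℕ → ℂ} {A : ℝ} (hA : 0 < A) (hb : b 0 = A)
    {R : ℂ → ℂ}
    (hL : ∀ z : ℂ, 0 < z.re → ∫ t : ℝ, Complex.exp (-(z * t)) ∂ν =
      ∑ j ∈ s, b j * ∫ t : ℝ, Complex.exp (-(z * t)) ∂(powMeasure (r j)) + R z)
    {β : ℝ} (hβ0 : 0 ≤ β) (hβ : β < 1) (hR : ∀ y : ℝ, MildAt β R y)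
    (hRd : ∀ z : ℂ, 0 < z.re → ContDiffAt ℂ 1 R z) {d : ℝ} (hd : 0 < d) :
    Tendsto (fun x : ℝ => x ^ (1 - r 0) * ∫ t in Set.Iic x, Real.exp (d * (t - x)) ∂ν) atTop
      (𝓝 (A / d)) := by
  -- The kernel has to decay fast enough to be integrable against `t ^ (r 0 - 1) dt`.
  obtain ⟨q, hq⟩ := exists_nat_gt (r 0 + 1)
  obtain ⟨p, K, k, c, C, hqp, hc, hC, hKc, hk, hks, hKl, hKu, hK⟩ := exists_kernel q
  have hqp' : (q : ℝ) ≤ p := by exact_mod_cast hqp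
  have hKpos : ∀ u, 0 < K u := fun u => lt_of_lt_of_le (by positivity) (hKl u)
  have hrle : ∀ j ∈ s, r j ≤ r 0 := fun j hj => by
    rcases eq_or_ne j 0 with rfl | hj0
    · exact le_rfl
    · exact (hr0 j hj hj0).le
  have hrp : ∀ j ∈ s, r j + 1 < p := fun j hj => by linarith [hrle j hj]
  have hp1 : (1 : ℝ) < p := by linarith [hr 0 hs]
  obtain ⟨hKν, hcomp⟩ := exists_comparison hν0 hν hr hL hβ0 hβ hR hRd hk hks hKc
    (fun u => (hKpos u).le) (fun j hj => by linarith [hrp j hj]) hKu hK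
  have hbase : ∀ u : ℝ, 1 / (1 + |u|) ^ p ≤ c⁻¹ * K u := fun u => by
    rw [le_inv_mul_iff₀ hc, mul_one_div]
    exact hKl u
  have hKi : Integrable K := by
    have h1 : Integrable fun u : ℝ => C * (1 + ‖u‖) ^ (-(p : ℝ)) :=
      (integrable_one_add_norm (by simpa using hp1)).const_mul C
    refine h1.mono' hKc.aestronglyMeasurable (ae_of_all _ fun u => ?_)
    rw [Real.norm_of_nonneg (hKpos u).le, Real.rpow_neg (by positivity), Real.rpow_natCast,
      ← div_eq_mul_inv]
    exact hKu u
  have hmod : ∀ ξ : ℝ, Tendsto (fun x : ℝ => ((x ^ (1 - r 0) : ℝ) : ℂ) *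
      ∫ t : ℝ, (K (t - x) : ℂ) * Complex.exp (ξ * (t - x : ℝ) * Complex.I) ∂ν) atTop
      (𝓝 (A * ∫ u : ℝ, (K u : ℂ) * Complex.exp (ξ * u * Complex.I))) := by
    intro ξ
    obtain ⟨B, hB⟩ := hcomp ξ
    have hKξ : ∀ u : ℝ, ‖(K u : ℂ) * Complex.exp (ξ * u * Complex.I)‖ ≤ C / (1 + |u|) ^ p := by
      intro u
      rw [norm_mul, ← Complex.ofReal_mul, Complex.norm_exp_ofReal_mul_I, mul_one,
        Complex.norm_real, Real.norm_of_nonneg (hKpos u).le]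
      exact hKu u
    have hmodel : ∀ j ∈ s, Tendsto (fun x : ℝ => ((x ^ (1 - r 0) : ℝ) : ℂ) * (b j *
        ∫ t : ℝ, (K (t - x) : ℂ) * Complex.exp (ξ * (t - x : ℝ) * Complex.I) ∂(powMeasure (r j))))
        atTop (𝓝 (if j = 0 then A * ∫ u : ℝ, (K u : ℂ) * Complex.exp (ξ * u * Complex.I)
          else 0)) := by
      intro j hj
      have h1 := (tendsto_integral_powMeasure (hr j hj) (hrp j hj)
        (K := fun u : ℝ => (K u : ℂ) * Complex.exp (ξ * u * Complex.I))
        (by fun_prop) hKξ).const_mul (b j)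
      split_ifs with hj0
      · subst hj0
        rw [← hb]
        refine h1.congr fun x => ?_
        ring
      · have h2 : Tendsto (fun x : ℝ => x ^ (-(r 0 - r j))) atTop (𝓝 0) :=
          tendsto_rpow_neg_atTop (by linarith [hr0 j hj hj0])
        have h3 := ((Complex.continuous_ofReal.tendsto 0).comp h2).mul h1
        rw [Complex.ofReal_zero, zero_mul] at h3
        refine h3.congr' ?_
        filter_upwards [eventually_gt_atTop 0] with x hx
        simp only [Function.comp]
        rw [show (1 - r 0) = -(r 0 - r j) + (1 - r j) by ring, Real.rpow_add hx]
        push_cast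
        ring
    have hsum := tendsto_finsetSum s hmodel
    rw [Finset.sum_ite_eq' s 0, if_pos hs] at hsum
    have herr : Tendsto (fun x : ℝ => ((x ^ (1 - r 0) : ℝ) : ℂ) *
        (∫ t : ℝ, (K (t - x) : ℂ) * Complex.exp (ξ * (t - x : ℝ) * Complex.I) ∂ν -
        ∑ j ∈ s, b j * ∫ t : ℝ, (K (t - x) : ℂ) * Complex.exp (ξ * (t - x : ℝ) * Complex.I)
          ∂(powMeasure (r j)))) atTop (𝓝 0) := by
      have h1 : Tendsto (fun x : ℝ => B * x ^ (-(r 0))) atTop (𝓝 0) := by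
        simpa using (tendsto_rpow_neg_atTop (hr 0 hs)).const_mul B
      refine squeeze_zero_norm' ?_ h1
      filter_upwards [eventually_gt_atTop 0] with x hx
      rw [norm_mul, Complex.norm_real, Real.norm_of_nonneg (Real.rpow_nonneg hx.le _)]
      calc _ ≤ x ^ (1 - r 0) * (B / x) := by
            gcongr
            exact hB x hx
        _ = _ := by
            rw [Real.rpow_sub hx, Real.rpow_neg hx.le, Real.rpow_one]
            field_simp
    have := herr.add hsum
    rw [zero_add] at this
    refine this.congr fun x => ?_
    rw [← Finset.mul_sum]
    ring
  refine tendsto_integral_exp_Iic (p := p) (fun x hx => Real.rpow_nonneg hx.le _) hA hd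
    (fun x hx => ?_) fun ψ hψ hM => ?_
  · refine ((hKν x hx).const_mul c⁻¹).mono' ?_ (ae_of_all _ fun t => ?_)
    · refine Continuous.aestronglyMeasurable ?_
      exact continuous_const.div (by fun_prop) fun t => by positivity
    · rw [Real.norm_of_nonneg (by positivity)]
      exact hbase _
  · obtain ⟨M, hM⟩ := hM
    refine tendsto_integral_of_tendsto_modulated (M := |M| * c⁻¹)
      (fun x hx => Real.rpow_nonneg hx.le _) hKc hKpos hKi hA hKν hmod hψ fun u => ?_
    calc |ψ u| ≤ M * (1 / (1 + |u|) ^ p) := hM u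
      _ ≤ |M| * (1 / (1 + |u|) ^ p) := by
          gcongr
          exact le_abs_self M
      _ ≤ |M| * (c⁻¹ * K u) := by
          gcongr
          exact hbase u
      _ = _ := by ring

/-! ### Roots of analytic functions near the boundary -/

lemma mildAt_of_analyticAt {β : ℝ} (hβ : 0 ≤ β) {f : ℂ → ℂ} {y : ℝ}
    (hf : AnalyticAt ℂ f (Complex.I * y)) : MildAt β f y := by
  have h1 : ∀ᶠ z in 𝓝 (Complex.I * y), DifferentiableAt ℂ f z ∧ ‖f z‖ < ‖f (Complex.I * y)‖ + 1 ∧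
      ‖deriv f z‖ < ‖deriv f (Complex.I * y)‖ + 1 := by
    filter_upwards [hf.eventually_analyticAt,
      hf.continuousAt.norm.eventually_lt_const (lt_add_one _),
      hf.deriv.continuousAt.norm.eventually_lt_const (lt_add_one _)] with z h1 h2 h3
    exact ⟨h1.differentiableAt, h2, h3⟩
  obtain ⟨δ, hδ, h⟩ := Metric.eventually_nhds_iff.1 h1
  refine ⟨min δ 1, by positivity,
    ‖f (Complex.I * y)‖ + ‖deriv f (Complex.I * y)‖ + 1, fun z hz hzd => ?_⟩
  obtain ⟨h1, h2, h3⟩ := h (by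
    rw [dist_eq_norm]
    exact hzd.trans_le (min_le_left _ _))
  have hz0 : 0 < ‖z - Complex.I * y‖ := by
    rw [norm_pos_iff, sub_ne_zero]
    rintro rfl
    simp at hz
  have h4 : 1 ≤ ‖z - Complex.I * y‖ ^ (-β) :=
    Real.one_le_rpow_of_pos_of_le_one_of_nonpos hz0 (hzd.le.trans (min_le_right _ _)) (by linarith)
  refine ⟨h1, by linarith [norm_nonneg (deriv f (Complex.I * y))], ?_⟩
  have h5 := norm_nonneg (f (Complex.I * y))
  have h6 := norm_nonneg (deriv f (Complex.I * y))
  nlinarith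

lemma MildAt.sub {β : ℝ} {f g : ℂ → ℂ} {y : ℝ} (hf : MildAt β f y) (hg : MildAt β g y) :
    MildAt β (fun z => f z - g z) y := by
  obtain ⟨δ, hδ, C, hC⟩ := hf
  obtain ⟨δ', hδ', C', hC'⟩ := hg
  refine ⟨min δ δ', lt_min hδ hδ', C + C', fun z hz hzd => ?_⟩
  obtain ⟨h1, h2, h3⟩ := hC z hz (hzd.trans_le (min_le_left _ _))
  obtain ⟨h1', h2', h3'⟩ := hC' z hz (hzd.trans_le (min_le_right _ _))
  refine ⟨h1.sub h1', (norm_sub_le _ _).trans (add_le_add h2 h2'), ?_⟩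
  rw [deriv_fun_sub h1 h1', add_mul]
  exact (norm_sub_le _ _).trans (add_le_add h3 h3')

/-- A holomorphic `m`-th root of an analytic function is mild at the boundary. If the analytic
function vanishes to order `n`, the root behaves like the `n / m`-th power of the distance, which
for `n ≥ 1` has a derivative no larger than the `(1 / m - 1)`-th power. -/
lemma mildAt_of_pow_eq {m : ℕ} (hm : 0 < m) {F H : ℂ → ℂ} {y : ℝ}
    (hF : ∀ z : ℂ, 0 < z.re → DifferentiableAt ℂ F z) (hH : AnalyticAt ℂ H (Complex.I * y))
    (hFH : ∀ᶠ z in 𝓝 (Complex.I * y), 0 < z.re → F z ^ m = H z) :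
    MildAt (1 - 1 / (m : ℝ)) F y := by
  set w : ℂ := Complex.I * y with hw
  have hm1 : (1 : ℝ) ≤ m := by exact_mod_cast hm
  have hm0 : (m : ℝ) ≠ 0 := by positivity
  have hmi : 1 / (m : ℝ) ≤ 1 := by
    rw [div_le_one (by positivity)]
    exact hm1
  by_cases hzero : ∀ᶠ z in 𝓝 w, H z = 0
  · obtain ⟨δ, hδ, h⟩ := Metric.eventually_nhds_iff.1 (hFH.and hzero)
    have hF0 : ∀ z : ℂ, 0 < z.re → ‖z - w‖ < δ → F z = 0 := fun z hz hzd => by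
      obtain ⟨h1, h2⟩ := h (y := z) (by rwa [dist_eq_norm])
      exact eq_zero_of_pow_eq_zero ((h1 hz).trans h2)
    refine ⟨δ, hδ, 0, fun z hz hzd => ⟨hF z hz, by simp [hF0 z hz hzd], ?_⟩⟩
    have : F =ᶠ[𝓝 z] fun _ => 0 := by
      have ho : IsOpen ({z : ℂ | 0 < z.re} ∩ Metric.ball w δ) :=
        (isOpen_lt continuous_const Complex.continuous_re).inter Metric.isOpen_ball
      filter_upwards [ho.mem_nhds ⟨hz, mem_ball_iff_norm.2 hzd⟩] with v hv
      exact hF0 v hv.1 (mem_ball_iff_norm.1 hv.2)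
    rw [this.deriv_eq]
    simp
  obtain ⟨n, g, hg, hg0, hgH⟩ :=
    hH.exists_eventuallyEq_pow_smul_nonzero_iff.2 hzero
  set c : ℝ := ‖g w‖ / 2 with hc
  have hcpos : 0 < c := by positivity
  have hnear : ∀ᶠ z in 𝓝 w, (0 < z.re → F z ^ m = (z - w) ^ n * g z) ∧ DifferentiableAt ℂ g z ∧
      c < ‖g z‖ ∧ ‖g z‖ < ‖g w‖ + 1 ∧ ‖deriv g z‖ < ‖deriv g w‖ + 1 := by
    filter_upwards [hFH, hgH, hg.eventually_analyticAt,
      hg.continuousAt.norm.eventually_const_lt (by linarith : c < ‖g w‖),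
      hg.continuousAt.norm.eventually_lt_const (lt_add_one _),
      hg.deriv.continuousAt.norm.eventually_lt_const (lt_add_one _)] with z h1 h2 h3 h4 h5 h6
    exact ⟨fun hz => by rw [h1 hz, h2, smul_eq_mul], h3.differentiableAt, h4, h5, h6⟩
  obtain ⟨δ, hδ, h⟩ := Metric.eventually_nhds_iff.1 hnear
  set M : ℝ := ‖g w‖ + 1 with hM
  set M' : ℝ := ‖deriv g w‖ + 1 with hM'
  have hM1 : 1 ≤ M := by linarith [norm_nonneg (g w)]
  have hM'0 : 0 < M' := by positivity
  refine ⟨min δ 1, by positivity, M + M * (n * M + M') / (m * c), fun z hz hzd => ?_⟩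
  have hzδ : dist z w < δ := by
    rw [dist_eq_norm]
    exact hzd.trans_le (min_le_left _ _)
  obtain ⟨e1, hgd, e2, e3, e4⟩ := h hzδ
  set t : ℝ := ‖z - w‖ with ht
  have hzw : z - w ≠ 0 := by
    rw [sub_ne_zero]
    rintro rfl
    simp [hw] at hz
  have ht0 : 0 < t := norm_pos_iff.2 hzw
  have ht1 : t ≤ 1 := hzd.le.trans (min_le_right _ _)
  have hnormpow : ‖F z‖ ^ m = t ^ n * ‖g z‖ := by
    rw [← norm_pow, e1 hz, norm_mul, norm_pow]
  have hFM : ‖F z‖ ≤ M := by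
    refine le_of_pow_le_pow_left₀ hm.ne' (by linarith) ?_
    rw [hnormpow]
    calc t ^ n * ‖g z‖ ≤ 1 * M := by
          gcongr
          exact pow_le_one₀ ht0.le ht1
      _ ≤ M ^ m := by
          rw [one_mul]
          exact le_self_pow₀ hM1 hm.ne'
  have hpos : 0 ≤ M * (n * M + M') / (m * c) := by positivity
  refine ⟨hF z hz, by linarith, ?_⟩
  -- Logarithmic differentiation of `F ^ m = (z - w) ^ n * g`.
  have hlog : m * (g z * (z - w)) * deriv F z = F z * (n * g z + (z - w) * deriv g z) := by
    have hd1 : HasDerivAt (fun v => F v ^ m) (m * F z ^ (m - 1) * deriv F z) z :=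
      (hF z hz).hasDerivAt.pow m
    have hd2 : HasDerivAt (fun v => (v - w) ^ n * g v)
        (n * (z - w) ^ (n - 1) * g z + (z - w) ^ n * deriv g z) z := by
      have := (((hasDerivAt_id z).sub_const w).pow n).mul hgd.hasDerivAt
      simpa using! this
    have heq : (fun v => F v ^ m) =ᶠ[𝓝 z] fun v => (v - w) ^ n * g v := by
      have ho : IsOpen ({z : ℂ | 0 < z.re} ∩ Metric.ball w δ) :=
        (isOpen_lt continuous_const Complex.continuous_re).inter Metric.isOpen_ball
      filter_upwards [ho.mem_nhds ⟨hz, hzδ⟩] with v hv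
      exact (h hv.2).1 hv.1
    have hd := (hd2.congr_of_eventuallyEq heq).unique hd1
    have hFm : F z * F z ^ (m - 1) = (z - w) ^ n * g z := by
      rw [← e1 hz, ← pow_succ', Nat.sub_add_cancel hm]
    have hn : (n : ℂ) * (z - w) ^ (n - 1) * (z - w) = n * (z - w) ^ n := by
      rcases Nat.eq_zero_or_pos n with hn0 | hn0
      · simp [hn0]
      · rw [mul_assoc, ← pow_succ, Nat.sub_add_cancel hn0]
    refine mul_left_cancel₀ (pow_ne_zero n hzw) ?_
    calc (z - w) ^ n * (m * (g z * (z - w)) * deriv F z)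
        = m * ((z - w) ^ n * g z) * deriv F z * (z - w) := by ring
      _ = F z * (m * F z ^ (m - 1) * deriv F z) * (z - w) := by
          rw [← hFm]
          ring
      _ = F z * ((n * (z - w) ^ (n - 1) * (z - w)) * g z + (z - w) ^ n * deriv g z * (z - w)) := by
          rw [← hd]
          ring
      _ = _ := by
          rw [hn]
          ring
  have hderiv : ‖deriv F z‖ * (m * c * t) ≤ ‖F z‖ * (n * M + t * M') := by
    have h1 := congrArg norm hlog
    rw [norm_mul, norm_mul, norm_mul, norm_mul, Complex.norm_natCast] at h1
    calc ‖deriv F z‖ * (m * c * t) ≤ ‖deriv F z‖ * (m * ‖g z‖ * t) := by gcongr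
      _ = ‖F z‖ * ‖n * g z + (z - w) * deriv g z‖ := by
          rw [← h1]
          ring
      _ ≤ ‖F z‖ * (n * M + t * M') := by
          gcongr
          refine (norm_add_le _ _).trans ?_
          rw [norm_mul, norm_mul, Complex.norm_natCast]
          gcongr
  have hfin : ‖F z‖ * (n * M + t * M') ≤ M * (n * M + M') * t ^ (1 / (m : ℝ)) := by
    have htm : t ≤ t ^ (1 / (m : ℝ)) := by
      simpa using Real.rpow_le_rpow_of_exponent_ge ht0 ht1 hmi
    have htm0 : 0 ≤ t ^ (1 / (m : ℝ)) := by positivity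
    rcases Nat.eq_zero_or_pos n with hn0 | hn0
    · simp only [hn0, Nat.cast_zero, zero_mul, zero_add]
      calc ‖F z‖ * (t * M') ≤ M * (t ^ (1 / (m : ℝ)) * M') := by gcongr
        _ = _ := by ring
    · have h1 : ‖F z‖ ≤ M * t ^ (1 / (m : ℝ)) := by
        refine le_of_pow_le_pow_left₀ hm.ne' (by positivity) ?_
        rw [hnormpow, mul_pow, ← Real.rpow_mul_natCast ht0.le, one_div_mul_cancel hm0,
          Real.rpow_one]
        calc t ^ n * ‖g z‖ ≤ t * M := by
              gcongr
              exact pow_le_of_le_one ht0.le ht1 hn0.ne'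
          _ ≤ M ^ m * t := by
              rw [mul_comm]
              gcongr
              exact le_self_pow₀ hM1 hm.ne'
      calc ‖F z‖ * (n * M + t * M') ≤ (M * t ^ (1 / (m : ℝ))) * (n * M + 1 * M') := by gcongr
        _ = _ := by ring
  rw [neg_sub, Real.rpow_sub ht0, Real.rpow_one]
  have hdiv : ‖deriv F z‖ ≤ M * (n * M + M') / (m * c) * (t ^ (1 / (m : ℝ)) / t) := by
    rw [div_mul_div_comm, le_div_iff₀ (by positivity)]
    exact hderiv.trans hfin
  refine hdiv.trans (mul_le_mul_of_nonneg_right (by linarith) (by positivity))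

open scoped ComplexOrder in
/-- Near the pole, the `m`-th root is `z ^ (-l / m)` times an analytic function. The two sides have
the same `m`-th power, so they differ by a constant root of unity, which is `1` because `F` is
nonnegative on the positive reals. -/
lemma exists_analyticAt_eq_cpow_mul {m l : ℕ} (hm : 0 < m) {F G : ℂ → ℂ} {A : ℝ} (hA : 0 < A)
    (hF : ∀ z : ℂ, 0 < z.re → DifferentiableAt ℂ F z)
    (hFpos : ∀ x : ℝ, 0 < x → 0 ≤ F x)
    (hG : AnalyticAt ℂ G 0) (hG0 : G 0 = (A : ℂ) ^ m)
    (hFG : ∀ᶠ z in 𝓝 (0 : ℂ), 0 < z.re → F z ^ m * z ^ l = G z) :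
    ∃ g : ℂ → ℂ, AnalyticAt ℂ g 0 ∧ g 0 = A ∧
      ∀ᶠ z in 𝓝 (0 : ℂ), 0 < z.re → F z = z ^ (-((l / m : ℝ) : ℂ)) * g z := by
  have hm' : (m : ℂ) ≠ 0 := by exact_mod_cast hm.ne'
  have hAm : G 0 = ((A ^ m : ℝ) : ℂ) := by rw [hG0]; push_cast; rfl
  have hslit : G 0 ∈ Complex.slitPlane := by
    rw [hAm]
    exact Complex.ofReal_mem_slitPlane.2 (by positivity)
  set g : ℂ → ℂ := fun z => G z ^ ((m : ℂ)⁻¹) with hg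
  have hgan : AnalyticAt ℂ g 0 := hG.cpow analyticAt_const hslit
  have hgm : ∀ z, g z ^ m = G z := fun z => Complex.cpow_nat_inv_pow _ hm.ne'
  have hg0 : g 0 = A := by
    simp only [hg]
    rw [hG0]
    exact Complex.pow_cpow_nat_inv hm.ne' (by
      rw [Complex.arg_ofReal_of_nonneg hA.le]
      simpa using (by positivity : (0 : ℝ) < Real.pi / m)) (by
      rw [Complex.arg_ofReal_of_nonneg hA.le]
      positivity)
  refine ⟨g, hgan, hg0, ?_⟩
  have hne : ∀ᶠ z in 𝓝 (0 : ℂ), g z ≠ 0 :=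
    hgan.continuousAt.eventually_ne (by rw [hg0]; exact_mod_cast hA.ne')
  obtain ⟨δ, hδ, h⟩ := Metric.eventually_nhds_iff.1
    ((hFG.and hne).and (hgan.eventually_analyticAt))
  set D : Set ℂ := {z : ℂ | 0 < z.re} ∩ Metric.ball 0 δ with hD
  have hDpre : IsPreconnected D :=
    ((convex_halfSpace_re_gt 0).inter (convex_ball 0 δ)).isPreconnected
  set Q : ℂ → ℂ := fun z => F z * z ^ ((l / m : ℝ) : ℂ) / g z with hQ
  have hz0 : ∀ z : ℂ, 0 < z.re → z ≠ 0 := by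
    rintro z hz rfl
    simp at hz
  have hpow : ∀ z : ℂ, (z ^ ((l / m : ℝ) : ℂ)) ^ m = z ^ l := by
    intro z
    rw [← Complex.cpow_mul_nat]
    push_cast
    rw [div_mul_cancel₀ _ hm', Complex.cpow_natCast]
  have hQ1 : ∀ z ∈ D, Q z ^ m = 1 := by
    intro z hz
    obtain ⟨⟨h1, h2⟩, -⟩ := h hz.2
    simp only [hQ]
    rw [div_pow, mul_pow, hpow, h1 hz.1, hgm, div_self]
    rw [← hgm]
    exact pow_ne_zero m h2
  have hQc : ContinuousOn Q D := by
    intro z hz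
    obtain ⟨⟨h1, h2⟩, h3⟩ := h hz.2
    refine ContinuousAt.continuousWithinAt ?_
    refine ((hF z hz.1).continuousAt.mul ?_).div h3.continuousAt h2
    exact continuousAt_id.cpow continuousAt_const (Or.inl hz.1)
  have hfin : {q : ℂ | q ^ m = 1}.Finite := by
    have : {q : ℂ | q ^ m = 1} ⊆ ((Polynomial.nthRoots m (1 : ℂ)).toFinset : Set ℂ) := by
      intro q hq
      simpa [Polynomial.mem_nthRoots hm] using hq
    exact (Finset.finite_toSet _).subset this
  obtain ⟨ω, hω, hQω⟩ := hDpre.eqOn_const_of_mapsTo hfin.isDiscrete hQc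
    (fun z hz => hQ1 z hz) ⟨1, one_pow m⟩
  have hFω : ∀ z ∈ D, F z * z ^ ((l / m : ℝ) : ℂ) = ω * g z := by
    intro z hz
    have h1 := hQω hz
    obtain ⟨⟨-, h2⟩, -⟩ := h hz.2
    simp only [hQ, Function.const] at h1
    exact (div_eq_iff h2).1 h1
  -- Along the positive reals `F z * z ^ (l / m)` is nonnegative and tends to `ω * A`.
  have hωA : 0 ≤ ω * A := by
    have htend : Tendsto (fun x : ℝ => ω * g x) (𝓝[>] 0) (𝓝 (ω * A)) := by
      have h1 : Tendsto (fun x : ℝ => g x) (𝓝[>] 0) (𝓝 (A : ℂ)) := by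
        have h2 : Tendsto (fun x : ℝ => (x : ℂ)) (𝓝[>] 0) (𝓝 0) :=
          (Complex.continuous_ofReal.tendsto' 0 0 Complex.ofReal_zero).mono_left
            nhdsWithin_le_nhds
        rw [← hg0]
        exact hgan.continuousAt.tendsto.comp h2
      exact h1.const_mul ω
    refine ge_of_tendsto htend ?_
    filter_upwards [Ioo_mem_nhdsGT hδ] with x hx
    have hxD : (x : ℂ) ∈ D := by
      refine ⟨by simpa using hx.1, ?_⟩
      rw [mem_ball_zero_iff, Complex.norm_real, Real.norm_of_nonneg hx.1.le]
      exact hx.2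
    rw [← hFω _ hxD, ← Complex.ofReal_cpow hx.1.le]
    exact mul_nonneg (hFpos x hx.1) (by
      exact_mod_cast Real.rpow_nonneg hx.1.le _)
  have hω1 : ω = 1 := by
    obtain ⟨h1, h2⟩ := Complex.nonneg_iff.1 hωA
    rw [Complex.re_mul_ofReal] at h1
    rw [Complex.im_mul_ofReal, zero_eq_mul, or_iff_left hA.ne'] at h2
    obtain ⟨x, hx, rfl⟩ : ∃ x : ℝ, 0 ≤ x ∧ (x : ℂ) = ω :=
      ⟨ω.re, nonneg_of_mul_nonneg_left h1 hA, Complex.ext rfl (by simp [h2])⟩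
    have hx1 : x ^ m = 1 := by
      have : (x : ℂ) ^ m = 1 := hω
      exact_mod_cast this
    rw [(pow_eq_one_iff_of_nonneg hx hm.ne').1 hx1, Complex.ofReal_one]
  filter_upwards [Metric.ball_mem_nhds (0 : ℂ) hδ] with z hzδ hz
  have h1 := hFω z ⟨hz, hzδ⟩
  rw [hω1, one_mul] at h1
  rw [← h1, Complex.cpow_neg, mul_comm (F z), inv_mul_cancel_left₀]
  rw [Complex.cpow_ne_zero_iff]
  exact Or.inl (hz0 z hz)

/-! ### The remainder after the singular terms -/

/-- Subtracting from `F` the finitely many terms of its expansion at the pole that are unbounded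
there leaves a function that is mild along the whole boundary. -/
lemma exists_mild_remainder {m l : ℕ} (hm : 0 < m) {F H G : ℂ → ℂ} {A : ℝ} (hA : 0 < A)
    (hF : ∀ z : ℂ, 0 < z.re → DifferentiableAt ℂ F z)
    (hFpos : ∀ x : ℝ, 0 < x → 0 ≤ (F x).re ∧ (F x).im = 0)
    (hFH : ∀ z : ℂ, 0 < z.re → F z ^ m = H z)
    (hH : ∀ y : ℝ, y ≠ 0 → AnalyticAt ℂ H (Complex.I * y))
    (hG : AnalyticAt ℂ G 0) (hG0 : G 0 = (A : ℂ) ^ m)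
    (hHG : ∀ᶠ z in 𝓝[≠] (0 : ℂ), H z * z ^ l = G z) :
    ∃ c : ℕ → ℂ, c 0 = A ∧ ∀ y : ℝ, MildAt (1 - 1 / (m : ℝ)) (fun z => F z -
      ∑ i ∈ Finset.range ⌈(l / m : ℝ)⌉₊, c i * z ^ (-((l / m - i : ℝ) : ℂ))) y := by
  have hm1 : (1 : ℝ) ≤ m := by exact_mod_cast hm
  have hm0 : (m : ℝ) ≠ 0 := by positivity
  have hm0' : (m : ℂ) ≠ 0 := by exact_mod_cast hm0
  have hβ : 0 ≤ 1 - 1 / (m : ℝ) := by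
    rw [sub_nonneg, div_le_one (by positivity)]
    exact hm1
  have hz0 : ∀ z : ℂ, 0 < z.re → z ≠ 0 := by
    rintro z hz rfl
    simp at hz
  have hFG : ∀ᶠ z in 𝓝 (0 : ℂ), 0 < z.re → F z ^ m * z ^ l = G z := by
    rw [eventually_nhdsWithin_iff] at hHG
    filter_upwards [hHG] with z h1 hz
    rw [hFH z hz]
    exact h1 (hz0 z hz)
  obtain ⟨g, hg, hg0, hFg⟩ := exists_analyticAt_eq_cpow_mul hm hA hF
    (fun x hx => Complex.nonneg_iff.2 ⟨(hFpos x hx).1, (hFpos x hx).2.symm⟩) hG hG0 hFG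
  set N : ℕ := ⌈(l / m : ℝ)⌉₊ with hN
  have hlN : l ≤ m * N := by
    have h1 : (l / m : ℝ) ≤ N := Nat.le_ceil _
    rw [div_le_iff₀ (by positivity)] at h1
    have h2 : (l : ℝ) ≤ ((m * N : ℕ) : ℝ) := by
      push_cast
      linarith
    exact_mod_cast h2
  obtain ⟨h, hh, hgh⟩ := hg.exists_eq_sum_add_pow_mul N
  refine ⟨fun i => iteratedDeriv i g 0 / i.factorial, by simp [hg0], fun y => ?_⟩
  have hterm : ∀ (i : ℕ) (z : ℂ), 0 < z.re → AnalyticAt ℂ (fun z : ℂ =>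
      iteratedDeriv i g 0 / i.factorial * z ^ (-((l / m - i : ℝ) : ℂ))) z := fun i z hz =>
    analyticAt_const.mul (analyticAt_id.cpow analyticAt_const (Or.inl hz))
  by_cases hy : y = 0
  · subst hy
    refine mildAt_of_pow_eq (H := fun z => z ^ (m * N - l) * h z ^ m) hm (fun z hz => ?_) ?_ ?_
    · exact (hF z hz).sub (DifferentiableAt.fun_sum fun i _ => (hterm i z hz).differentiableAt)
    · rw [Complex.ofReal_zero, mul_zero]
      exact (analyticAt_id.pow _).mul (hh.pow m)
    · rw [Complex.ofReal_zero, mul_zero]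
      filter_upwards [hFg] with z hz1 hz
      have hzne := hz0 z hz
      have hrem : F z - ∑ i ∈ Finset.range N,
          iteratedDeriv i g 0 / i.factorial * z ^ (-((l / m - i : ℝ) : ℂ)) =
          z ^ (-((l / m : ℝ) : ℂ)) * (z ^ N * h z) := by
        rw [hz1 hz, hgh z, mul_add, Finset.mul_sum, smul_eq_mul, add_sub_assoc, add_comm,
          sub_add_eq_add_sub, add_sub_assoc, ← Finset.sum_sub_distrib, Finset.sum_eq_zero, add_zero]
        intro i _
        rw [smul_eq_mul, sub_eq_zero, show -((l / m - i : ℝ) : ℂ) = -((l / m : ℝ) : ℂ) + (i : ℂ) by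
          push_cast; ring, Complex.cpow_add _ _ hzne, Complex.cpow_natCast]
        ring
      rw [hrem, mul_pow, mul_pow, ← pow_mul, mul_comm N m, ← Complex.cpow_mul_nat,
        show -((l / m : ℝ) : ℂ) * (m : ℂ) = -(l : ℂ) by push_cast; field_simp,
        Complex.cpow_neg, Complex.cpow_natCast, ← Nat.sub_add_cancel hlN, pow_add]
      have : z ^ l ≠ 0 := pow_ne_zero l hzne
      rw [Nat.add_sub_cancel]
      field_simp
  · refine MildAt.sub (mildAt_of_pow_eq hm hF (hH y hy)
      (Eventually.of_forall hFH)) (mildAt_of_analyticAt hβ ?_)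
    refine Finset.analyticAt_fun_sum _ fun i _ => analyticAt_const.mul
      (analyticAt_id.cpow analyticAt_const (Or.inr ?_))
    simpa using hy

/-- The measure with mass `w n` at the point `log n`, for nonnegative weights `w`. As
`log 0 = log 1 = 0`, the weight `w 0` counts at the origin. -/
noncomputable def logMeasure (w : ℕ → ℝ) : Measure ℝ :=
  ((Measure.count : Measure ℕ).withDensity fun n => ENNReal.ofReal (w n)).map
    fun n : ℕ => Real.log n

instance (w : ℕ → ℝ) : SFinite (logMeasure w) := by
  unfold logMeasure
  infer_instance

lemma ae_nonneg_logMeasure (w : ℕ → ℝ) : ∀ᵐ t ∂(logMeasure w), 0 ≤ t := by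
  rw [logMeasure, ae_map_iff (by fun_prop) (measurableSet_le measurable_const measurable_id')]
  exact ae_of_all _ fun n => Real.log_natCast_nonneg n

lemma integrable_logMeasure_iff {w : ℕ → ℝ} (hw : ∀ n, 0 ≤ w n) {E : Type*}
    [NormedAddCommGroup E] [NormedSpace ℝ E] [SecondCountableTopology E] {f : ℝ → E}
    (hf : StronglyMeasurable f) :
    Integrable f (logMeasure w) ↔ Summable fun n : ℕ => w n * ‖f (Real.log n)‖ := by
  rw [logMeasure, integrable_map_measure hf.aestronglyMeasurable (by fun_prop),
    integrable_withDensity_iff_integrable_smul' (by fun_prop)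
      (ae_of_all _ fun _ => ENNReal.ofReal_lt_top), integrable_count_iff]
  refine summable_congr fun n => ?_
  rw [Function.comp, ENNReal.toReal_ofReal (hw n), norm_smul, Real.norm_of_nonneg (hw n)]

lemma integral_logMeasure {w : ℕ → ℝ} (hw : ∀ n, 0 ≤ w n) {E : Type*}
    [NormedAddCommGroup E] [NormedSpace ℝ E] [CompleteSpace E] [SecondCountableTopology E]
    {f : ℝ → E} (hf : StronglyMeasurable f) (hfi : Integrable f (logMeasure w)) :
    ∫ t, f t ∂(logMeasure w) = ∑' n : ℕ, w n • f (Real.log n) := by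
  have hs := (integrable_logMeasure_iff hw hf).1 hfi
  have hc : Integrable (fun n : ℕ => w n • f (Real.log n)) Measure.count := by
    rw [integrable_count_iff]
    refine hs.congr fun n => ?_
    rw [norm_smul, Real.norm_of_nonneg (hw n)]
  rw [logMeasure, integral_map (by fun_prop) hf.aestronglyMeasurable,
    integral_withDensity_eq_integral_toReal_smul (by fun_prop)
      (ae_of_all _ fun _ => ENNReal.ofReal_lt_top)]
  simp_rw [fun n => ENNReal.toReal_ofReal (hw n)]
  rw [integral_countable hc]
  simp

/-! ### Dirichlet series -/

section DirichletSeries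

variable {a : ℕ → ℝ} {d : ℝ}

/-- The hypothesis says nothing about `a 0`, but the weight at `n = 0` vanishes since
`0 ^ (-d) = 0`. -/
lemma mul_rpow_neg_nonneg (ha : ∀ n : ℕ, 1 ≤ n → 0 ≤ a n) (hd : 0 < d) (n : ℕ) :
    0 ≤ a n * (n : ℝ) ^ (-d) := by
  rcases Nat.eq_zero_or_pos n with rfl | hn
  · simp [Real.zero_rpow (neg_ne_zero.2 hd.ne')]
  · exact mul_nonneg (ha n hn) (by positivity)

lemma term_eq_mul_exp (hd : 0 < d) (z : ℂ) (n : ℕ) :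
    LSeries.term (fun n => (a n : ℂ)) (d + z) n =
      ((a n * (n : ℝ) ^ (-d) : ℝ) : ℂ) * Complex.exp (-(z * (Real.log n : ℂ))) := by
  rcases Nat.eq_zero_or_pos n with rfl | hn
  · simp [Real.zero_rpow (neg_ne_zero.2 hd.ne')]
  · have hn0 : (n : ℂ) ≠ 0 := by exact_mod_cast hn.ne'
    rw [LSeries.term_of_ne_zero hn.ne', div_eq_mul_inv, ← Complex.cpow_neg, neg_add,
      Complex.cpow_add _ _ hn0, Complex.ofReal_mul, Complex.ofReal_cpow (by positivity),
      mul_assoc, Complex.cpow_def_of_ne_zero hn0 (-z), ← Complex.natCast_log]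
    push_cast
    congr 3
    ring

lemma norm_exp_neg_mul_ofReal (z : ℂ) (t : ℝ) :
    ‖Complex.exp (-(z * t))‖ = Real.exp (-(z.re * t)) := by
  rw [Complex.norm_exp]
  simp

lemma summable_mul_exp (ha : ∀ n : ℕ, 1 ≤ n → 0 ≤ a n) (hd : 0 < d)
    (hconv : ∀ s : ℂ, d < s.re → LSeriesSummable (fun n => (a n : ℂ)) s) {ε : ℝ} (hε : 0 < ε) :
    Summable fun n : ℕ => a n * (n : ℝ) ^ (-d) * Real.exp (-(ε * Real.log n)) := by
  have h := (hconv (d + ε) (by simpa using hε)).norm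
  refine h.congr fun n => ?_
  rw [term_eq_mul_exp hd, norm_mul, Complex.norm_real,
    Real.norm_of_nonneg (mul_rpow_neg_nonneg ha hd n), norm_exp_neg_mul_ofReal, Complex.ofReal_re]

lemma integrable_exp_logMeasure (ha : ∀ n : ℕ, 1 ≤ n → 0 ≤ a n) (hd : 0 < d)
    (hconv : ∀ s : ℂ, d < s.re → LSeriesSummable (fun n => (a n : ℂ)) s) {ε : ℝ} (hε : 0 < ε) :
    Integrable (fun t : ℝ => Real.exp (-(ε * t))) (logMeasure fun n => a n * (n : ℝ) ^ (-d)) := by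
  have hc : Continuous fun t : ℝ => Real.exp (-(ε * t)) := by fun_prop
  rw [integrable_logMeasure_iff (mul_rpow_neg_nonneg ha hd) hc.stronglyMeasurable]
  refine (summable_mul_exp ha hd hconv hε).congr fun n => ?_
  rw [Real.norm_of_nonneg (Real.exp_pos _).le]

lemma laplace_logMeasure (ha : ∀ n : ℕ, 1 ≤ n → 0 ≤ a n) (hd : 0 < d)
    (hconv : ∀ s : ℂ, d < s.re → LSeriesSummable (fun n => (a n : ℂ)) s) {z : ℂ} (hz : 0 < z.re) :
    ∫ t : ℝ, Complex.exp (-(z * t)) ∂(logMeasure fun n => a n * (n : ℝ) ^ (-d)) =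
      LSeries (fun n => (a n : ℂ)) (d + z) := by
  have hc : Continuous fun t : ℝ => Complex.exp (-(z * t)) := by fun_prop
  rw [integral_logMeasure (mul_rpow_neg_nonneg ha hd) hc.stronglyMeasurable]
  · refine tsum_congr fun n => ?_
    rw [term_eq_mul_exp hd, Complex.real_smul]
  · refine (integrable_exp_logMeasure ha hd hconv hz).mono' hc.aestronglyMeasurable
      (ae_of_all _ fun t => ?_)
    rw [norm_exp_neg_mul_ofReal]

/-- The partial sums of the coefficients in terms of the measure `logMeasure`. -/
lemma setIntegral_exp_logMeasure (ha : ∀ n : ℕ, 1 ≤ n → 0 ≤ a n) (hd : 0 < d) {X : ℝ}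
    (hX : 1 ≤ X) :
    ∫ t in Set.Iic (Real.log X), Real.exp (d * (t - Real.log X))
        ∂(logMeasure fun n => a n * (n : ℝ) ^ (-d)) =
      X ^ (-d) * ∑ n ∈ Finset.Icc 1 ⌊X⌋₊, a n := by
  have hX0 : 0 < X := by linarith
  set f : ℝ → ℝ := (Set.Iic (Real.log X)).indicator fun t => Real.exp (d * (t - Real.log X))
    with hf
  have hfm : StronglyMeasurable f := by
    refine (Measurable.indicator ?_ measurableSet_Iic).stronglyMeasurable
    fun_prop
  have hzero : ∀ n ∉ Finset.Icc 1 ⌊X⌋₊, a n * (n : ℝ) ^ (-d) * f (Real.log n) = 0 := by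
    intro n hn
    rcases Nat.eq_zero_or_pos n with rfl | hn0
    · simp [Real.zero_rpow (neg_ne_zero.2 hd.ne')]
    · have hnX : X < n := by
        rw [Finset.mem_Icc, not_and, not_le] at hn
        exact (Nat.floor_lt hX0.le).1 (hn hn0)
      have : Real.log n ∉ Set.Iic (Real.log X) := by
        simp only [Set.mem_Iic, not_le]
        exact Real.log_lt_log hX0 hnX
      rw [hf, Set.indicator_of_notMem this, mul_zero]
  have hfi : Integrable f (logMeasure fun n => a n * (n : ℝ) ^ (-d)) := by
    rw [integrable_logMeasure_iff (mul_rpow_neg_nonneg ha hd) hfm]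
    refine summable_of_ne_finset_zero (s := Finset.Icc 1 ⌊X⌋₊) fun n hn => ?_
    have := hzero n hn
    rcases mul_eq_zero.1 this with h | h <;> simp [h]
  rw [← integral_indicator measurableSet_Iic,
    integral_logMeasure (mul_rpow_neg_nonneg ha hd) hfm hfi]
  simp_rw [smul_eq_mul]
  rw [tsum_eq_sum hzero, Finset.mul_sum]
  refine Finset.sum_congr rfl fun n hn => ?_
  obtain ⟨hn1, hnX⟩ := Finset.mem_Icc.1 hn
  have hn0 : (0 : ℝ) < n := by exact_mod_cast hn1
  have hmem : Real.log n ∈ Set.Iic (Real.log X) :=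
    Real.log_le_log hn0 ((Nat.le_floor_iff hX0.le).1 hnX)
  rw [hf, Set.indicator_of_mem hmem, mul_sub, Real.exp_sub, mul_comm d, mul_comm d,
    ← Real.rpow_def_of_pos hn0, ← Real.rpow_def_of_pos hX0, Real.rpow_neg hn0.le,
    Real.rpow_neg hX0.le]
  have : (n : ℝ) ^ d ≠ 0 := (Real.rpow_pos_of_pos hn0 d).ne'
  field_simp

end DirichletSeries

/-- `LSeries` is the Dirichlet series `∑_{n ≥ 1} a n / n ^ s` (the term at `n = 0` is zero), and
`LSeriesSummable` is its absolute convergence. `H` is the meromorphic continuation of the `m`-th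
power of the Dirichlet series to the open set `U`. The conclusion is the relation `∼`: the
quotient of the two sides tends to `1` as the real variable `X` tends to infinity. -/
theorem theorem3p1 (a : ℕ → ℝ) (ha : ∀ n : ℕ, 1 ≤ n → 0 ≤ a n)
    (d : ℝ) (hd : 0 < d) (m l : ℕ) (hm : 0 < m) (hl : 0 < l)
    (hconv : ∀ s : ℂ, d < s.re → LSeriesSummable (fun n => (a n : ℂ)) s)
    (U : Set ℂ) (hU : IsOpen U) (hdU : {s : ℂ | d ≤ s.re} ⊆ U)
    (H : ℂ → ℂ) (hmer : MeromorphicOn H U)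
    (hext : ∀ s : ℂ, d < s.re → H s = LSeries (fun n => (a n : ℂ)) s ^ m)
    (hhol : DifferentiableOn ℂ H (U \ {(d : ℂ)}))
    (hpole : meromorphicOrderAt H (d : ℂ) = ((-(l : ℤ) : ℤ) : WithTop ℤ))
    (A : ℝ) (hA : 0 < A)
    (hlim : Tendsto (fun s : ℂ => H s * (s - (d : ℂ)) ^ l) (𝓝[≠] (d : ℂ)) (𝓝 ((A : ℂ) ^ m))) :
    Tendsto
      (fun X : ℝ => (∑ n ∈ Finset.Icc 1 ⌊X⌋₊, a n) /
        (A * X ^ d / (d * Real.Gamma ((l : ℝ) / (m : ℝ)) *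
          Real.log X ^ (1 - (l : ℝ) / (m : ℝ)))))
      atTop (𝓝 1) := by
  have hmR : (0 : ℝ) < m := by exact_mod_cast hm
  have hlR : (0 : ℝ) < l := by exact_mod_cast hl
  set ρ : ℝ := l / m with hρ
  have hρ0 : 0 < ρ := by positivity
  -- Translate the pole to the origin.
  set F : ℂ → ℂ := fun z => LSeries (fun n => (a n : ℂ)) (d + z) with hFdef
  have hdm : (d : ℂ) ∈ U := hdU (by simp)
  have hF : ∀ z : ℂ, 0 < z.re → DifferentiableAt ℂ F z := by
    intro z hz
    have habs : LSeries.abscissaOfAbsConv (fun n => (a n : ℂ)) < ((d + z : ℂ).re : EReal) := by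
      refine lt_of_le_of_lt (LSeries.abscissaOfAbsConv_le_of_forall_lt_LSeriesSummable
        (x := d) fun y hy => hconv y (by simpa using hy)) ?_
      rw [EReal.coe_lt_coe_iff]
      simpa using hz
    exact (LSeries_hasDerivAt habs).differentiableAt.comp (f := fun z => (d : ℂ) + z) z
      (by fun_prop)
  have hFpos : ∀ x : ℝ, 0 < x → 0 ≤ (F x).re ∧ (F x).im = 0 := by
    intro x hx
    have h : F x = ((∑' n : ℕ, a n * (n : ℝ) ^ (-d) * Real.exp (-(x * Real.log n)) : ℝ) : ℂ) := by
      rw [Complex.ofReal_tsum]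
      refine tsum_congr fun n => ?_
      rw [term_eq_mul_exp hd]
      push_cast
      rfl
    rw [h]
    exact ⟨tsum_nonneg fun n => mul_nonneg (mul_rpow_neg_nonneg ha hd n) (Real.exp_pos _).le,
      Complex.ofReal_im _⟩
  have hFH : ∀ z : ℂ, 0 < z.re → F z ^ m = H (d + z) := fun z hz =>
    (hext _ (by simpa using hz)).symm
  have hH : ∀ y : ℝ, y ≠ 0 → AnalyticAt ℂ (fun z => H (d + z)) (Complex.I * y) := by
    intro y hy
    have hopen : IsOpen (U \ {(d : ℂ)}) := hU.sdiff isClosed_singleton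
    have hmem : (d : ℂ) + Complex.I * y ∈ U \ {(d : ℂ)} :=
      ⟨hdU (by simp), by simpa using hy⟩
    exact (hhol.analyticAt (hopen.mem_nhds hmem)).comp_of_eq (f := fun z => (d : ℂ) + z)
      (analyticAt_const.add analyticAt_id) rfl
  -- The pole of order `l`: `H s * (s - d) ^ l` extends to an analytic function with value `A ^ m`.
  obtain ⟨G, hG, -, hHG⟩ := (meromorphicOrderAt_eq_int_iff (hmer d hdm)).1 hpole
  have hHG' : ∀ᶠ s in 𝓝[≠] (d : ℂ), H s * (s - d) ^ l = G s := by
    filter_upwards [hHG, self_mem_nhdsWithin] with s hs hsd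
    have : (s - d) ^ l ≠ 0 := pow_ne_zero l (sub_ne_zero.2 hsd)
    rw [hs, smul_eq_mul, zpow_neg, zpow_natCast]
    field_simp
  have hGA : G d = (A : ℂ) ^ m :=
    tendsto_nhds_unique ((hG.continuousAt.tendsto.mono_left nhdsWithin_le_nhds).congr'
      (hHG'.mono fun s hs => hs.symm)) hlim
  have hshift : Tendsto (fun z : ℂ => (d : ℂ) + z) (𝓝[≠] 0) (𝓝[≠] (d : ℂ)) := by
    refine tendsto_nhdsWithin_iff.2 ⟨?_, ?_⟩
    · exact ((by fun_prop : Continuous fun z : ℂ => (d : ℂ) + z).tendsto' 0 d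
        (add_zero _)).mono_left nhdsWithin_le_nhds
    · filter_upwards [self_mem_nhdsWithin] with z hz
      simpa using hz
  obtain ⟨c, hc0, hc⟩ := exists_mild_remainder (l := l) (H := fun z => H (d + z))
    (G := fun z => G (d + z)) hm hA hF hFpos hFH hH
    (hG.comp_of_eq (f := fun z => (d : ℂ) + z) (analyticAt_const.add analyticAt_id) (add_zero _))
    (by simpa using hGA) ((hshift.eventually hHG').mono fun z hz => by simpa using hz)
  -- Apply the Tauberian theorem to the point masses `a n * n ^ (-d)` at `log n`.
  have hpos : ∀ j ∈ Finset.range ⌈ρ⌉₊, 0 < ρ - j := fun j hj =>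
    sub_pos.2 (Nat.lt_ceil.1 (Finset.mem_range.1 hj))
  have hΓ : 0 < Real.Gamma ρ := Real.Gamma_pos_of_pos hρ0
  have hm1 : (1 : ℝ) ≤ m := by exact_mod_cast hm
  have hmain := tendsto_of_laplace_eq
    (ν := logMeasure fun n => a n * (n : ℝ) ^ (-d)) (s := Finset.range ⌈ρ⌉₊)
    (r := fun j => ρ - j) (b := fun j => c j / Real.Gamma (ρ - j)) (A := A / Real.Gamma ρ)
    (R := fun z => F z - ∑ i ∈ Finset.range ⌈ρ⌉₊, c i * z ^ (-((ρ - i : ℝ) : ℂ)))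
    (β := 1 - 1 / (m : ℝ)) (d := d)
    (ae_nonneg_logMeasure _) (fun ε hε => integrable_exp_logMeasure ha hd hconv hε)
    (Finset.mem_range.2 (Nat.ceil_pos.2 hρ0)) hpos
    (fun j _ hj => by
      have : (0 : ℝ) < j := by exact_mod_cast Nat.pos_of_ne_zero hj
      simpa using this)
    (by positivity) (by simp [hc0])
    (fun z hz => by
      rw [laplace_logMeasure ha hd hconv hz, Finset.sum_congr rfl fun j hj => by
        rw [laplace_powMeasure (hpos j hj) hz, ← mul_assoc, div_mul_cancel₀ _ (by
          exact_mod_cast (Real.Gamma_pos_of_pos (hpos j hj)).ne')]]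
      ring)
    (by
      rw [sub_nonneg, div_le_one hmR]
      exact hm1)
    (by
      have : 0 < 1 / (m : ℝ) := by positivity
      linarith)
    hc
    (fun z hz => by
      refine ContDiffAt.sub ?_ (ContDiffAt.sum fun i _ => contDiffAt_const.mul ?_)
      · have hdo : DifferentiableOn ℂ F {z : ℂ | 0 < z.re} := fun z hz =>
          (hF z hz).differentiableWithinAt
        exact (hdo.analyticAt ((isOpen_lt continuous_const Complex.continuous_re).mem_nhds
          hz)).contDiffAt
      · exact (analyticAt_id.cpow analyticAt_const (Or.inl hz)).contDiffAt)
    hd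
  have hlog := (hmain.comp Real.tendsto_log_atTop).const_mul (d * Real.Gamma ρ / A)
  rw [show d * Real.Gamma ρ / A * (A / Real.Gamma ρ / d) = 1 by field_simp] at hlog
  refine hlog.congr' ?_
  filter_upwards [eventually_gt_atTop 1] with X hX
  have hX0 : 0 < X := by linarith
  have hlX : 0 < Real.log X := Real.log_pos hX
  simp only [Function.comp, Nat.cast_zero, sub_zero]
  rw [setIntegral_exp_logMeasure ha hd hX.le, Real.rpow_neg hX0.le]
  have h1 : X ^ d ≠ 0 := (Real.rpow_pos_of_pos hX0 d).ne'
  have h2 : Real.log X ^ (1 - ρ) ≠ 0 := (Real.rpow_pos_of_pos hlX _).ne'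
  field_simp
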